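/- **Setting.** Let $G$ be a graph with a finite set of edges (parallel edges allowed; each edge may be directed or undirected), with start vertex $s_G$ and goal vertex $t_G$. Suppose that there is at least one $s_G$-$t_G$ path (no vertex visited twice) and that all $s_G$-$t_G$ paths have the same number $L\ge 1$ of edges; let $E$ be the number of edges of $G$. Fix a congestion window $\Delta\ge 1$. A history is a sequence of $\Delta$ $s_G$-$t_G$ paths; $\#(h,e)\in\{0,\dots,\Delta\}$ is the number of entries of the history $h$ that use the edge $e$. There are unknown means $\mu_e\in[0,1]$ and an unknown congestion function $f(e,j)\in(0,1]$ for edges $e$ and $0\le j\le\Delta$. Starting from an arbitrary initial history $h_1$, in each round $t=1,\dots,T$ the learner picks an $s_G$-$t_G$ path $p_t$, observes and receives for each edge $e$ of $p_t$ the reward $\tilde r_{t}(e)=f(e,\#(h_t,e))\,\mu_e+\epsilon_{t,e}$, and $h_{t+1}$ arises from $h_t$ by dropping the oldest entry and appending $p_t$. The noise variables $\epsilon_{t,e}$ are standard Gaussian, and the noise vectors $(\epsilon_{t,e})_e$ of different rounds are independent (the dependence among edges within a round is arbitrary, so that both independent noise and one common noise variable per round are covered). Let $\Pi$ be the set of maps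 from histories to $s_G$-$t_G$ paths (stationary policies), write $r(h,p)=\sum_{e\in p}f(e,\#(h,e))\mu_e$, and let $h_t^\pi$ be the history at time $t$ when $\pi\in\Pi$ is run from $h_1$. The policy regret is $$\lambda_T=\sup_{\pi\in\Pi}\sum_{t=1}^T r(h_t^\pi,\pi(h_t^\pi))-\sum_{t=1}^T\sum_{e\in p_t}\tilde r_t(e).$$ **Algorithm (Carmab-st with confidence $\delta\in(0,1)$ and constant $\kappa$).** It works in episodes. When an episode starts in round $t_0$, let $N(e,j)$ be the number of earlier rounds $\tau$ with $e\in p_\tau$ and $\#(h_\tau,e)=j$, and let $\hat r(e,j)$ be the sum of the rewards of $e$ observed in these rounds divided by $\max\{1,N(e,j)\}$. Let $\mathcal R$ be the set of all tables $r(e,j)\in[0,1]$ with $$|r(e,j)-\hat r(e,j)|\le\kappa\sqrt{\frac{\log(LE\Delta t_0/\delta)}{\max\{1,N(e,j)\}}}\quad\text{for all }(e,j).$$ The learner selects a policy $\tilde\pi\in\Pi$ that, together with some $r\in\mathcal R$, maximizes over $\Pi\times\mathcal R$ the long-run average reward $\lim_{n\to\infty}\frac1n\sum_{k=1}^n\sum_{e}r(e,\#(\cdot,e))$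 of the policy run from the current history, where among the maximizers one is taken that makes no detour, i.e. whose run from the current history is, after $\Delta$ rounds, on the cycle of histories that it then repeats. Ties are otherwise broken in any way that depends measurably on $\hat r$ (and arbitrarily on $t_0$, $N$ and the current history); if $\mathcal R=\emptyset$ the policy is arbitrary. It plays $\tilde\pi$ until, for some pair $(e,j)$, the number of observations of $(e,j)$ in the episode reaches $\max\{1,N(e,j)\}$; then the next episode starts. **Theorem.** For every $\kappa\ge 10$ there is a constant $c>0$, depending on $\kappa$ only, such that for every such $G,s_G,t_G$, every $\Delta\ge 1$ and every $\delta\in(0,1)$: such a selection rule exists, and for every such selection rule, all $f$, $\mu$, $h_1$ as above and every horizon $T\ge 1$, the policy regret of Carmab-st satisfies, with probability at least $1-\delta$, $$\lambda_T\le c\,L\Delta^2E\,\log^+\!\Big(\frac{LT}{\Delta E}\Big)+c\sqrt{LE\Delta T\log\Big(\frac{LE\Delta T}{\delta}\Big)}+c\sqrt{TL\log\Big(\frac1\delta\Big)},$$ where $\log^+x=\max\{\log x,0\}$. -/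

import Mathlib

open MeasureTheory ProbabilityTheory Filter Topology

noncomputable section

namespace CongestedRouting

universe u v

/-- A multigraph with vertex type `V` and edge type `E`. An edge may be
one-way (usable only from `src` to `tgt`) or two-way, so that directed graphs, undirected graphs
and mixed graphs are all covered. -/
structure RGraph (V : Type u) (E : Type v) where
  src : E → V
  tgt : E → V
  oneWay : E → Prop

/-- The edge `e` can be traversed from `x` to `y`. -/
def RGraph.Traverses {V : Type u} {E : Type v} (G : RGraph V E) (e : E) (x y : V) : Prop :=
  (G.src e = x ∧ G.tgt e = y) ∨ (¬ G.oneWay e ∧ G.tgt e = x ∧ G.src e = y)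

/-- `G.IsWalk x y vs es`: `es` is the list of edges, and `vs` the list of vertices, of a walk
from `x` to `y`. -/
inductive RGraph.IsWalk {V : Type u} {E : Type v} (G : RGraph V E) :
    V → V → List V → List E → Prop
  | nil (x : V) : RGraph.IsWalk G x x [x] []
  | cons {x y z : V} {vs : List V} {e : E} {es : List E} (h : G.Traverses e x y)
      (w : RGraph.IsWalk G y z vs es) : RGraph.IsWalk G x z (x :: vs) (e :: es)

/-- An `a`-`b` path: the list of the edges of a walk from `a` to `b` that visits no vertex
twice. -/
structure STPath {V : Type u} {E : Type v} (G : RGraph V E) (a b : V) where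
  edges : List E
  isPath : ∃ vs : List V, G.IsWalk a b vs edges ∧ vs.Nodup

theorem RGraph.IsWalk.ends_mem {V : Type u} {E : Type v} {G : RGraph V E} {x y : V}
    {vs : List V} {es : List E} (w : G.IsWalk x y vs es) :
    x ∈ vs ∧ ∀ e ∈ es, G.src e ∈ vs ∧ G.tgt e ∈ vs := by
  induction w with
  | nil x => simp
  | @cons x y z vs e es h w ih =>
    refine ⟨List.mem_cons_self, fun d hd => ?_⟩
    rcases List.mem_cons.1 hd with rfl | hd
    · rcases h with ⟨h1, h2⟩ | ⟨_, h1, h2⟩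
      · exact ⟨by simp [h1], by rw [h2]; exact List.mem_cons_of_mem _ ih.1⟩
      · exact ⟨by rw [h2]; exact List.mem_cons_of_mem _ ih.1, by simp [h1]⟩
    · exact ⟨List.mem_cons_of_mem _ (ih.2 d hd).1, List.mem_cons_of_mem _ (ih.2 d hd).2⟩

theorem RGraph.IsWalk.edges_nodup {V : Type u} {E : Type v} {G : RGraph V E} {x y : V}
    {vs : List V} {es : List E} (w : G.IsWalk x y vs es) (hn : vs.Nodup) : es.Nodup := by
  induction w with
  | nil x => simp
  | @cons x y z vs e es h w ih =>
    rw [List.nodup_cons] at hn ⊢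
    refine ⟨fun he => hn.1 ?_, ih hn.2⟩
    have := w.ends_mem.2 e he
    rcases h with ⟨h1, _⟩ | ⟨_, h1, _⟩
    · exact h1 ▸ this.1
    · exact h1 ▸ this.2

theorem STPath.edges_nodup {V : Type u} {E : Type v} {G : RGraph V E} {a b : V}
    (p : STPath G a b) : p.edges.Nodup := by
  obtain ⟨vs, w, hn⟩ := p.isPath
  exact w.edges_nodup hn

instance STPath.instFinite {V : Type u} {E : Type v} [Finite E] (G : RGraph V E) (a b : V) :
    Finite (STPath G a b) := by
  classical
  have := Fintype.ofFinite E
  refine Finite.of_injective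
    (fun p : STPath G a b => (⟨p.edges, p.edges_nodup⟩ : {l : List E // l.Nodup})) ?_
  rintro ⟨p, hp⟩ ⟨q, hq⟩ h
  simpa using h

section Model

variable {V : Type u} {E : Type v} [Fintype E] [DecidableEq E]

/-- The set of edges of a path. -/
def STPath.edgeSet {G : RGraph V E} {a b : V} (p : STPath G a b) : Finset E := p.edges.toFinset

/-- A history: the paths chosen in the last `Δ` rounds, the oldest one first. -/
abbrev History (G : RGraph V E) (a b : V) (Δ : ℕ) := Fin Δ → STPath G a b

/-- A stationary policy. -/
abbrev Policy (G : RGraph V E) (a b : V) (Δ : ℕ) := History G a b Δ → STPath G a b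

/-- One number for each edge `e` and each count `j ∈ {0, …, Δ}`. -/
abbrev RTable (E : Type v) (Δ : ℕ) := E → Fin (Δ + 1) → ℝ

/-- One natural number for each edge `e` and each count `j ∈ {0, …, Δ}`. -/
abbrev CTable (E : Type v) (Δ : ℕ) := E → Fin (Δ + 1) → ℕ

variable {G : RGraph V E} {a b : V} {Δ : ℕ}

/-- The number of rounds of the history `h` in which the edge `e` was used. -/
def useCount (h : History G a b Δ) (e : E) : Fin (Δ + 1) :=
  ⟨(Finset.univ.filter fun i : Fin Δ => e ∈ (h i).edgeSet).card,
    Nat.lt_succ_of_le ((Finset.card_le_univ _).trans_eq (Fintype.card_fin Δ))⟩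

/-- The history after the path `p` is played: the oldest entry is dropped and `p` is appended. -/
def push (h : History G a b Δ) (p : STPath G a b) : History G a b Δ :=
  fun i => if hi : (i : ℕ) + 1 < Δ then h ⟨(i : ℕ) + 1, hi⟩ else p

/-- The reward of the path `p` at the history `h` for the edge rewards `r e j`. -/
def pathReward (r : RTable E Δ) (h : History G a b Δ) (p : STPath G a b) : ℝ :=
  ∑ e ∈ p.edgeSet, r e (useCount h e)

/-- One round of the policy `π`. -/
def policyStep (π : Policy G a b Δ) (h : History G a b Δ) : History G a b Δ := push h (π h)

/-- The total reward of the policy `π` in `n` rounds, from the history `h`. -/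
def policyReward (r : RTable E Δ) (π : Policy G a b Δ) (h : History G a b Δ) (n : ℕ) : ℝ :=
  ∑ k ∈ Finset.range n,
    pathReward r ((policyStep π)^[k] h) (π ((policyStep π)^[k] h))

/-- `ρ` is the long-run average reward of the policy `π`, run from the history `h`. -/
def HasAvgReward (r : RTable E Δ) (π : Policy G a b Δ) (h : History G a b Δ) (ρ : ℝ) : Prop :=
  Tendsto (fun n : ℕ => policyReward r π h n / n) atTop (𝓝 ρ)

/-- The set of feasible rewards of an episode which starts in round `t₀`, when the pair `(e, j)`
was observed `N e j` times with empirical mean `rhat e j`. -/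
def feasible (κ δ : ℝ) (L t₀ : ℕ) (N : CTable E Δ) (rhat : RTable E Δ) : Set (RTable E Δ) :=
  {r | ∀ e j, r e j ∈ Set.Icc (0 : ℝ) 1 ∧
    |r e j - rhat e j| ≤
      κ * √(Real.log ((L * Fintype.card E * Δ * t₀ : ℝ) / δ) / ((max 1 (N e j) : ℕ) : ℝ))}

/-- `π` is an optimistic policy for the set `R` of rewards at the history `h`: together with some
`r ∈ R` it maximizes the long-run average reward from `h` over all policies and all rewards in
`R`, and it makes no detour, that is, after `Δ` rounds it is on the cycle that it then repeats. -/
def IsOptimistic (R : Set (RTable E Δ)) (h : History G a b Δ) (π : Policy G a b Δ) : Prop :=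
  (∃ r ∈ R, ∃ ρ : ℝ, HasAvgReward r π h ρ ∧
    ∀ r' ∈ R, ∀ (π' : Policy G a b Δ) (ρ' : ℝ), HasAvgReward r' π' h ρ' → ρ' ≤ ρ) ∧
  (policyStep π)^[Δ] h ∈ Function.periodicPts (policyStep π)

/-- A rule that selects the policy of an episode from its first round, the counts and empirical
means of the earlier episodes, and the current history. -/
abbrev Planner (G : RGraph V E) (a b : V) (Δ : ℕ) :=
  ℕ → CTable E Δ → RTable E Δ → History G a b Δ → Policy G a b Δ

/-- The planner always selects an optimistic policy (an arbitrary one if no reward is feasible),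
with ties broken in a measurable way. -/
structure IsOptimisticPlanner (κ δ : ℝ) (L : ℕ) (plan : Planner G a b Δ) : Prop where
  optimistic : ∀ (t₀ : ℕ) (N : CTable E Δ) (rhat : RTable E Δ) (h : History G a b Δ),
    (feasible κ δ L t₀ N rhat).Nonempty →
      IsOptimistic (feasible κ δ L t₀ N rhat) h (plan t₀ N rhat h)
  measurable : ∀ (t₀ : ℕ) (N : CTable E Δ) (h : History G a b Δ) (π : Policy G a b Δ),
    MeasurableSet {rhat : RTable E Δ | plan t₀ N rhat h = π}

/-- The memory of the learner before a round. -/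
structure LearnerState (G : RGraph V E) (a b : V) (Δ : ℕ) where
  /-- the number of the coming round -/
  round : ℕ
  /-- the paths of the last `Δ` rounds -/
  hist : History G a b Δ
  /-- the number of observations of `(e, j)` in earlier episodes -/
  prior : CTable E Δ
  /-- the number of observations of `(e, j)` in the current episode -/
  cur : CTable E Δ
  /-- the sum of all rewards observed so far for `(e, j)` -/
  rewardSum : RTable E Δ
  /-- the policy of the current episode -/
  policy : Policy G a b Δ

/-- The path that the learner chooses in the coming round. -/
def LearnerState.path (S : LearnerState G a b Δ) : STPath G a b := S.policy S.hist

/-- Start of a new episode. -/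
def LearnerState.newEpisode (plan : Planner G a b Δ) (S : LearnerState G a b Δ) :
    LearnerState G a b Δ :=
  let N : CTable E Δ := fun e j => S.prior e j + S.cur e j
  { S with
    prior := N
    cur := fun _ _ => 0
    policy := plan S.round N (fun e j => S.rewardSum e j / ((max 1 (N e j) : ℕ) : ℝ)) S.hist }

/-- The learner's bookkeeping in a round in which its path was played and the reward `y e` was
observed for each edge `e` of this path (the values of `y` at other edges are not used). -/
def LearnerState.record (S : LearnerState G a b Δ) (y : E → ℝ) : LearnerState G a b Δ :=
  { S with
    round := S.round + 1
    hist := push S.hist S.path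
    cur := fun e j =>
      if e ∈ S.path.edgeSet ∧ useCount S.hist e = j then S.cur e j + 1 else S.cur e j
    rewardSum := fun e j =>
      if e ∈ S.path.edgeSet ∧ useCount S.hist e = j then S.rewardSum e j + y e
      else S.rewardSum e j }

open Classical in
/-- One round of the learner: the current episode goes on as long as every pair `(e, j)` has been
observed in it fewer than `max {1, N e j}` times, with `N e j` the number of observations in
earlier episodes. -/
def LearnerState.next (plan : Planner G a b Δ) (S : LearnerState G a b Δ) (y : E → ℝ) :
    LearnerState G a b Δ :=
  if ∀ e j, (S.record y).cur e j < max 1 ((S.record y).prior e j) then S.record y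
  else (S.record y).newEpisode plan

/-- The learner before round `1`, with initial history `h₁`. -/
def LearnerState.first (plan : Planner G a b Δ) (h₁ : History G a b Δ) : LearnerState G a b Δ :=
  { round := 1
    hist := h₁
    prior := fun _ _ => 0
    cur := fun _ _ => 0
    rewardSum := fun _ _ => 0
    policy := plan 1 (fun _ _ => 0) (fun _ _ => 0) h₁ }

/-- The mean rewards: the mean `μ e`, discounted by the congestion factor `f e j`. -/
def meanReward (f : RTable E Δ) (μ : E → ℝ) : RTable E Δ := fun e j => f e j * μ e

/-- The learner after `k` rounds against mean rewards `r`, when `ε i e` is the noise of the edge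
`e` in round `i + 1`. -/
def run (plan : Planner G a b Δ) (h₁ : History G a b Δ) (r : RTable E Δ) (ε : ℕ → E → ℝ) :
    ℕ → LearnerState G a b Δ
  | 0 => LearnerState.first plan h₁
  | k + 1 =>
    let S := run plan h₁ r ε k
    S.next plan fun e => r e (useCount S.hist e) + ε k e

/-- The policy regret after `T` rounds: the largest total mean reward of a stationary policy,
minus the total observed reward of the learner. -/
def policyRegret (plan : Planner G a b Δ) (h₁ : History G a b Δ) (r : RTable E Δ)
    (ε : ℕ → E → ℝ) (T : ℕ) : ℝ :=
  (⨆ π : Policy G a b Δ, policyReward r π h₁ T) -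
    ∑ k ∈ Finset.range T, ∑ e ∈ (run plan h₁ r ε k).path.edgeSet,
      (r e (useCount (run plan h₁ r ε k).hist e) + ε k e)

end Model

end CongestedRouting

end

set_option linter.unusedSectionVars false

/-! The learner faces a deterministic decision process whose states are the histories. A history
forgets everything older than `Δ` rounds, so every state is reached from every other one in exactly
`Δ` moves (`playHist_ofFn`). Hence any walk closes up at the cost of `Δ` extra moves, and a closed
walk splits into simple cycles, each of which a stationary policy can repeat. So `n` rounds from any
state earn at most `n + Δ` times the optimal gain (`playReward_le_of_closed`,
`playReward_le_of_avg`). For the same reason a gain-optimal policy without detour never lags its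
gain `ρ` by more than `2Δρ` (`mul_sub_policyReward_le`).

The rest is optimism. As long as the true table is feasible, the optimistic gain of an episode is at
least the true optimal gain. The episode then loses at most `2ΔL` plus twice the confidence widths
along its path (`episode_regret_le`, `run_regret_le`). The doubling rule is used twice. Each new
episode doubles the count of some pair, and concavity of the logarithm bounds the number of episodes
(`potential_le`); this gives the logarithmic term. Moreover the counts frozen at the start of an
episode are outdated by a factor of at most two, so the widths telescope and Cauchy-Schwarz gives
the square-root term (`sum_inv_sqrt_prior_le`, `sum_width_le`).

For the noise, the set of edges whose noise is summed in a round is determined by the past, so the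
exponential weights form a supermartingale whatever the dependence within a round
(`lintegral_prod_expWeight_le`). The tail bound `measure_noiseSum_ge_le` serves both for feasibility
(`measure_exists_not_feasible_le`) and for the noise in the received rewards
(`measure_total_noise_le`). With at least two edges the latter is absorbed by the square-root term;
with one edge there is only one path, and the regret is pure noise. -/

namespace CongestedRouting

/-! ### Walks of histories, cycles and long-run averages -/

section Dynamics

variable {V : Type*} {E : Type*} [Fintype E] [DecidableEq E]
variable {G : RGraph V E} {a b : V} {Δ : ℕ}

/-- The history after the paths in `l` are played in turn. -/
def playHist (h : History G a b Δ) (l : List (STPath G a b)) : History G a b Δ :=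
  l.foldl push h

/-- The total reward of playing the paths in `l` in turn. -/
def playReward (r : RTable E Δ) : History G a b Δ → List (STPath G a b) → ℝ
  | _, [] => 0
  | h, p :: l => pathReward r h p + playReward r (push h p) l

@[simp] theorem playHist_nil (h : History G a b Δ) : playHist h [] = h := rfl

@[simp] theorem playHist_cons (h : History G a b Δ) (p : STPath G a b) (l) :
    playHist h (p :: l) = playHist (push h p) l := rfl

theorem playHist_append (h : History G a b Δ) (l l' : List (STPath G a b)) :
    playHist h (l ++ l') = playHist (playHist h l) l' := by
  simp [playHist, List.foldl_append]

theorem playReward_append (r : RTable E Δ) (h : History G a b Δ) (l l' : List (STPath G a b)) :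
    playReward r h (l ++ l') = playReward r h l + playReward r (playHist h l) l' := by
  induction l generalizing h with
  | nil => simp [playReward]
  | cons p l ih => simp [playReward, ih, add_assoc]

theorem playHist_apply (l : List (STPath G a b)) (h : History G a b Δ) (k : Fin Δ) :
    playHist h l k = if hk : (k : ℕ) + l.length < Δ then h ⟨k + l.length, hk⟩
      else l[(k : ℕ) + l.length - Δ]'(by have := k.2; omega) := by
  induction l generalizing h with
  | nil => simp
  | cons p l ih =>
    rw [playHist_cons, ih]
    by_cases h1 : (k : ℕ) + l.length < Δ
    · rw [dif_pos h1]
      by_cases h2 : (k : ℕ) + l.length + 1 < Δ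
      · have h3 : (k : ℕ) + (p :: l).length < Δ := by simp; omega
        rw [dif_pos h3]
        simp only [push, dif_pos h2]
        congr 1
      · have h3 : ¬ (k : ℕ) + (p :: l).length < Δ := by simp; omega
        rw [dif_neg h3]
        simp only [push, dif_neg h2]
        have : (k : ℕ) + (p :: l).length - Δ = 0 := by simp; omega
        simp only [this, List.getElem_cons_zero]
    · have h3 : ¬ (k : ℕ) + (p :: l).length < Δ := by simp; omega
      rw [dif_neg h1, dif_neg h3]
      have : (k : ℕ) + (p :: l).length - Δ = ((k : ℕ) + l.length - Δ) + 1 := by simp; omega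
      simp only [this, List.getElem_cons_succ]

/-- Playing the entries of `s` overwrites all of `h`: the process has diameter at most `Δ`. -/
theorem playHist_ofFn (h s : History G a b Δ) : playHist h (List.ofFn s) = s := by
  funext k
  rw [playHist_apply]
  simp

theorem pathReward_nonneg {r : RTable E Δ} (hr : ∀ e j, 0 ≤ r e j) (h : History G a b Δ)
    (p : STPath G a b) : 0 ≤ pathReward r h p :=
  Finset.sum_nonneg fun _ _ => hr _ _

theorem STPath.card_edgeSet (p : STPath G a b) : p.edgeSet.card = p.edges.length :=
  List.toFinset_card_of_nodup p.edges_nodup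

theorem pathReward_le {r : RTable E Δ} (hr : ∀ e j, r e j ≤ 1) {L : ℕ}
    (hL : ∀ p : STPath G a b, p.edges.length = L) (h : History G a b Δ)
    (p : STPath G a b) : pathReward r h p ≤ L := by
  calc pathReward r h p ≤ ∑ e ∈ p.edgeSet, (1 : ℝ) := Finset.sum_le_sum fun _ _ => hr _ _
    _ = L := by simp [p.card_edgeSet, hL p]

theorem playReward_nonneg {r : RTable E Δ} (hr : ∀ e j, 0 ≤ r e j) (l : List (STPath G a b))
    (h : History G a b Δ) : 0 ≤ playReward r h l := by
  induction l generalizing h with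
  | nil => simp [playReward]
  | cons p l ih => exact add_nonneg (pathReward_nonneg hr _ _) (ih _)

theorem policyReward_nonneg {r : RTable E Δ} (hr : ∀ e j, 0 ≤ r e j) (π : Policy G a b Δ)
    (h : History G a b Δ) (n : ℕ) : 0 ≤ policyReward r π h n :=
  Finset.sum_nonneg fun _ _ => pathReward_nonneg hr _ _

theorem policyReward_le {r : RTable E Δ} (hr : ∀ e j, r e j ≤ 1) {L : ℕ}
    (hL : ∀ p : STPath G a b, p.edges.length = L) (π : Policy G a b Δ)
    (h : History G a b Δ) (n : ℕ) : policyReward r π h n ≤ n * L := by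
  calc policyReward r π h n ≤ ∑ _k ∈ Finset.range n, (L : ℝ) :=
        Finset.sum_le_sum fun _ _ => pathReward_le hr hL _ _
    _ = n * L := by simp

theorem policyReward_add (r : RTable E Δ) (π : Policy G a b Δ) (h : History G a b Δ) (m n : ℕ) :
    policyReward r π h (m + n) =
      policyReward r π h m + policyReward r π ((policyStep π)^[m] h) n := by
  simp only [policyReward, Finset.sum_range_add]
  congr 1
  refine Finset.sum_congr rfl fun k _ => ?_
  rw [← Function.iterate_add_apply, Nat.add_comm]

/-- The paths that the policy `π` plays in `n` rounds from `h`. -/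
def policyPaths (π : Policy G a b Δ) (h : History G a b Δ) (n : ℕ) : List (STPath G a b) :=
  (List.range n).map fun k => π ((policyStep π)^[k] h)

@[simp] theorem length_policyPaths (π : Policy G a b Δ) (h : History G a b Δ) (n : ℕ) :
    (policyPaths π h n).length = n := by simp [policyPaths]

theorem policyPaths_succ (π : Policy G a b Δ) (h : History G a b Δ) (n : ℕ) :
    policyPaths π h (n + 1) = policyPaths π h n ++ [π ((policyStep π)^[n] h)] := by
  simp [policyPaths, List.range_succ]

theorem playHist_policyPaths (π : Policy G a b Δ) (h : History G a b Δ) (n : ℕ) :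
    playHist h (policyPaths π h n) = (policyStep π)^[n] h := by
  induction n with
  | zero => simp [policyPaths]
  | succ n ih =>
    rw [policyPaths_succ, playHist_append, ih, Function.iterate_succ_apply']
    rfl

theorem playReward_policyPaths (r : RTable E Δ) (π : Policy G a b Δ) (h : History G a b Δ)
    (n : ℕ) : playReward r h (policyPaths π h n) = policyReward r π h n := by
  induction n with
  | zero => simp [policyPaths, playReward, policyReward]
  | succ n ih =>
    rw [policyPaths_succ, playReward_append, ih, playHist_policyPaths]
    simp [policyReward, Finset.sum_range_succ, playReward]

/-- A finite prefix contributes a fixed amount, which vanishes after division by `n`; gains may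
therefore be computed on the cycle that is eventually reached. -/
theorem hasAvgReward_iterate (r : RTable E Δ) (π : Policy G a b Δ) (h : History G a b Δ)
    (m : ℕ) (ρ : ℝ) :
    HasAvgReward r π ((policyStep π)^[m] h) ρ ↔ HasAvgReward r π h ρ := by
  have key : ∀ n : ℕ, policyReward r π ((policyStep π)^[m] h) n =
      policyReward r π h (n + m) - policyReward r π h m := fun n => by
    rw [Nat.add_comm, policyReward_add]; ring
  have hc : Tendsto (fun n : ℕ => policyReward r π h m / (n : ℝ)) atTop (𝓝 0) :=
    tendsto_const_div_atTop_nhds_zero_nat _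
  have hq : Tendsto (fun n : ℕ => ((n + m : ℕ) : ℝ) / (n : ℝ)) atTop (𝓝 1) := by
    have h1 : Tendsto (fun n : ℕ => 1 + (m : ℝ) / n) atTop (𝓝 (1 + 0)) :=
      tendsto_const_nhds.add (tendsto_const_div_atTop_nhds_zero_nat _)
    rw [add_zero] at h1
    refine h1.congr' ?_
    filter_upwards [eventually_gt_atTop 0] with n hn
    have : (n : ℝ) ≠ 0 := by positivity
    push_cast
    field_simp
  have hq' : Tendsto (fun n : ℕ => (n : ℝ) / ((n + m : ℕ) : ℝ)) atTop (𝓝 1) := by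
    have := hq.inv₀ one_ne_zero
    simpa using this
  unfold HasAvgReward
  constructor
  · intro H
    rw [← tendsto_add_atTop_iff_nat m]
    have := (H.add hc).mul hq'
    rw [add_zero, mul_one] at this
    refine this.congr' ?_
    filter_upwards [eventually_gt_atTop 0] with n hn
    have h1 : (n : ℝ) ≠ 0 := by positivity
    have h2 : ((n + m : ℕ) : ℝ) ≠ 0 := by positivity
    rw [key]
    field_simp
    ring
  · intro H
    have := (((tendsto_add_atTop_iff_nat m).2 H).mul hq).sub hc
    rw [sub_zero, mul_one] at this
    refine this.congr' ?_
    filter_upwards [eventually_gt_atTop 0] with n hn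
    have h1 : (n : ℝ) ≠ 0 := by positivity
    have h2 : ((n + m : ℕ) : ℝ) ≠ 0 := by positivity
    rw [key]
    field_simp

/-- The deviation of the total reward from linear growth is periodic in time, hence bounded. -/
theorem hasAvgReward_of_iterate_eq (r : RTable E Δ) (π : Policy G a b Δ) (h : History G a b Δ)
    {n : ℕ} (hn : 0 < n) (hper : (policyStep π)^[n] h = h) :
    HasAvgReward r π h (policyReward r π h n / n) := by
  have hn' : (n : ℝ) ≠ 0 := by positivity
  set c := policyReward r π h n / n with hc
  set u : ℕ → ℝ := fun N => policyReward r π h N - N * c with hu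
  have hup : Function.Periodic u n := by
    intro N
    simp only [hu]
    rw [Nat.add_comm N n, policyReward_add, hper, hc]
    push_cast
    field_simp
    ring
  have hbd : ∀ N, |u N| ≤ ∑ i ∈ Finset.range n, |u i| := by
    intro N
    rw [← hup.map_mod_nat N]
    exact Finset.single_le_sum (f := fun i => |u i|) (fun i _ => abs_nonneg _)
      (Finset.mem_range.2 (Nat.mod_lt _ hn))
  have h0 : Tendsto (fun N : ℕ => u N / N) atTop (𝓝 0) := by
    refine squeeze_zero_norm (a := fun N : ℕ => (∑ i ∈ Finset.range n, |u i|) / N) ?_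
      (tendsto_const_div_atTop_nhds_zero_nat _)
    intro N
    rw [Real.norm_eq_abs, abs_div, Nat.abs_cast]
    exact div_le_div_of_nonneg_right (hbd N) (Nat.cast_nonneg _)
  have h1 := h0.add_const c
  rw [zero_add] at h1
  refine h1.congr' ?_
  filter_upwards [eventually_gt_atTop 0] with N hN
  have : (N : ℝ) ≠ 0 := by positivity
  simp only [hu]
  field_simp
  ring

/-- Lets a policy be changed freely off an invariant set, as in splicing an approach route onto a
cycle. -/
theorem policyReward_congr (r : RTable E Δ) {π π' : Policy G a b Δ} {C : Set (History G a b Δ)}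
    (hC : ∀ x ∈ C, policyStep π x ∈ C) (hpp : ∀ x ∈ C, π' x = π x) {x : History G a b Δ}
    (hx : x ∈ C) (n : ℕ) :
    (policyStep π')^[n] x = (policyStep π)^[n] x ∧ (policyStep π)^[n] x ∈ C ∧
      policyReward r π' x n = policyReward r π x n := by
  induction n with
  | zero => simp [hx, policyReward]
  | succ n ih =>
    obtain ⟨h1, h2, h3⟩ := ih
    refine ⟨?_, ?_, ?_⟩
    · rw [Function.iterate_succ_apply', Function.iterate_succ_apply', h1]
      simp [policyStep, hpp _ h2]
    · rw [Function.iterate_succ_apply']; exact hC _ h2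
    · simp only [policyReward, Finset.sum_range_succ] at h3 ⊢
      rw [h3, h1, hpp _ h2]

/-- Every cycle of a policy can be reached from every history within `Δ` rounds by a policy
which then follows the cycle. -/
theorem exists_policy_reaching_cycle (σ : Policy G a b Δ) (s h₀ : History G a b Δ) {n : ℕ}
    (hn : 0 < n) (hper : (policyStep σ)^[n] s = s) :
    ∃ π : Policy G a b Δ, (policyStep π)^[Δ] h₀ ∈ Function.periodicPts (policyStep π) ∧
      ∀ r : RTable E Δ, HasAvgReward r π h₀ (policyReward r σ s n / n) := by
  classical
  set C : Set (History G a b Δ) := Set.range fun i : ℕ => (policyStep σ)^[i] s with hCdef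
  have hC : ∀ x ∈ C, policyStep σ x ∈ C := by
    rintro x ⟨i, rfl⟩
    exact ⟨i + 1, Function.iterate_succ_apply' _ _ _⟩
  have hsC : s ∈ C := ⟨0, rfl⟩
  have hCper : ∀ x ∈ C, (policyStep σ)^[n] x = x := by
    rintro x ⟨i, rfl⟩
    simp only
    rw [← Function.iterate_add_apply, Nat.add_comm, Function.iterate_add_apply, hper]
  have hreach : ∀ x : History G a b Δ, ∃ m, ∃ l : List (STPath G a b),
      l.length = m ∧ playHist x l ∈ C := fun x => ⟨_, List.ofFn s, rfl, by
        rw [playHist_ofFn]; exact hsC⟩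
  -- The distance to the cycle. Off the cycle the new policy always lowers it, so it takes at most
  -- `Δ` rounds to arrive.
  set d : History G a b Δ → ℕ := fun x => Nat.find (hreach x) with hd
  have hdle : ∀ x l, playHist x l ∈ C → d x ≤ l.length := fun x l hl =>
    Nat.find_min' (hreach x) ⟨l, rfl, hl⟩
  have hdzero : ∀ x, d x = 0 → x ∈ C := by
    intro x hx
    obtain ⟨l, hl, hlC⟩ := Nat.find_spec (hreach x)
    change l.length = d x at hl
    rw [hx, List.length_eq_zero_iff] at hl
    simpa [hl] using hlC
  have hstep : ∀ x, x ∉ C → ∃ p, d (push x p) < d x := by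
    intro x hx
    obtain ⟨l, hl, hlC⟩ := Nat.find_spec (hreach x)
    change l.length = d x at hl
    cases l with
    | nil => exact absurd (by simpa using hlC) hx
    | cons p l =>
      refine ⟨p, ?_⟩
      have := hdle (push x p) l (by simpa using hlC)
      simp at hl
      omega
  have : Nonempty (STPath G a b) := ⟨σ s⟩
  choose! q hq using hstep
  set π : Policy G a b Δ := fun x => if x ∈ C then σ x else q x with hπ
  have hπC : ∀ x ∈ C, π x = σ x := fun x hx => by simp [hπ, hx]
  have hdC : ∀ x ∈ C, d x = 0 := fun x hx =>
    Nat.le_zero.1 (hdle x [] (by simpa using hx))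
  have hmain : ∀ m x, d x ≤ m → (policyStep π)^[m] x ∈ C := by
    intro m
    induction m with
    | zero => intro x hx; exact hdzero x (Nat.le_zero.1 hx)
    | succ m ih =>
      intro x hx
      rw [Function.iterate_succ_apply]
      apply ih
      by_cases hxC : x ∈ C
      · have : policyStep π x ∈ C := by
          have := hC x hxC
          simpa [policyStep, hπC x hxC] using this
        rw [hdC _ this]; exact Nat.zero_le _
      · have := hq x hxC
        have h2 : policyStep π x = push x (q x) := by simp [policyStep, hπ, hxC]
        rw [h2]; omega
  have hΔ : (policyStep π)^[Δ] h₀ ∈ C := by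
    apply hmain
    have := hdle h₀ (List.ofFn s) (by rw [playHist_ofFn]; exact hsC)
    simpa using this
  refine ⟨π, ?_, fun r => ?_⟩
  · refine Function.mk_mem_periodicPts hn ?_
    change (policyStep π)^[n] _ = _
    rw [(policyReward_congr (r := 0) hC hπC hΔ n).1, hCper _ hΔ]
  · rw [← hasAvgReward_iterate r π h₀ Δ]
    have e1 : ∀ N, policyReward r π ((policyStep π)^[Δ] h₀) N =
        policyReward r σ ((policyStep π)^[Δ] h₀) N := fun N =>
      (policyReward_congr r hC hπC hΔ N).2.2
    have h2 : HasAvgReward r σ ((policyStep π)^[Δ] h₀) (policyReward r σ s n / n) := by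
      obtain ⟨i, hi⟩ := hΔ
      simp only at hi
      rw [← hi, hasAvgReward_iterate]
      exact hasAvgReward_of_iterate_eq r σ s hn hper
    unfold HasAvgReward at h2 ⊢
    simpa only [e1] using h2

/-- A bound for the long-run average rewards of the stationary policies bounds the mean reward
of every closed walk of histories. -/
theorem playReward_le_of_closed (r : RTable E Δ) (h₀ : History G a b Δ) (ρ : ℝ)
    (hρ : ∀ (π : Policy G a b Δ) (ρ' : ℝ), HasAvgReward r π h₀ ρ' → ρ' ≤ ρ)
    (l : List (STPath G a b)) (h : History G a b Δ) (hl : playHist h l = h) :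
    playReward r h l ≤ l.length * ρ := by
  classical
  induction hN : l.length using Nat.strong_induction_on generalizing l h with
  | _ N ih =>
  subst hN
  by_cases hsimple : ∀ i j, i < j → j < l.length → playHist h (l.take i) ≠ playHist h (l.take j)
  · rcases Nat.eq_zero_or_pos l.length with h0 | hpos
    · rw [List.length_eq_zero_iff] at h0
      simp [h0, playReward]
    obtain ⟨p₀, hp₀⟩ : ∃ p, p ∈ l := List.exists_mem_of_length_pos hpos
    -- The histories met on a simple closed walk are distinct, so a stationary policy can replay it.
    -- The default `p₀` plays no role on the walk.
    set σ : Policy G a b Δ := fun x =>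
      if hx : ∃ i : Fin l.length, playHist h (l.take i) = x then l.getD hx.choose p₀ else p₀ with hσ
    have hσi : ∀ (i : ℕ) (hi : i < l.length), σ (playHist h (l.take i)) = l[i] := by
      intro i hi
      have hx : ∃ k : Fin l.length, playHist h (l.take k) = playHist h (l.take i) := ⟨⟨i, hi⟩, rfl⟩
      have hsp := hx.choose_spec
      have hlt := hx.choose.2
      simp only [hσ, dif_pos hx]
      generalize hx.choose = k at hsp hlt
      have : (k : ℕ) = i := by
        rcases lt_trichotomy (k : ℕ) i with hlt' | heq | hgt
        · exact absurd hsp (hsimple _ _ hlt' hi)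
        · exact heq
        · exact absurd hsp.symm (hsimple _ _ hgt hlt)
      simp [this, hi]
    have hit : ∀ i ≤ l.length, (policyStep σ)^[i] h = playHist h (l.take i) ∧
        policyReward r σ h i = playReward r h (l.take i) := by
      intro i
      induction i with
      | zero => simp [policyReward, playReward]
      | succ i ihi =>
        intro hi
        obtain ⟨h1, h2⟩ := ihi (by omega)
        have hil : i < l.length := by omega
        rw [List.take_succ_eq_append_getElem hil]
        refine ⟨?_, ?_⟩
        · rw [Function.iterate_succ_apply', h1, playHist_append, policyStep, hσi i hil]
          simp
        · have : policyReward r σ h (i + 1) = policyReward r σ h i +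
              pathReward r ((policyStep σ)^[i] h) (σ ((policyStep σ)^[i] h)) := by
            simp [policyReward, Finset.sum_range_succ]
          rw [this, h2, playReward_append, h1, hσi i hil]
          simp [playReward]
    obtain ⟨h1, h2⟩ := hit l.length le_rfl
    rw [List.take_length] at h1 h2
    obtain ⟨π, -, hπ⟩ := exists_policy_reaching_cycle σ h h₀ hpos (h1.trans hl)
    have := hρ π _ (hπ r)
    rw [h2, div_le_iff₀ (by positivity)] at this
    linarith
  -- A repeated history cuts out a closed walk `l₂` and leaves the closed walk `l₁ ++ l₃`; both are
  -- strictly shorter, and lengths and rewards add up.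
  · push Not at hsimple
    obtain ⟨i, j, hij, hj, heq⟩ := hsimple
    have hlj : l.take j = l.take i ++ (l.drop i).take (j - i) := by
      conv_lhs => rw [show j = i + (j - i) by omega, List.take_add]
    set l₁ := l.take i with hl₁
    set l₂ := (l.drop i).take (j - i) with hl₂
    set l₃ := l.drop j with hl₃
    have hl123 : l = l₁ ++ l₂ ++ l₃ := by rw [← hlj, hl₃, List.take_append_drop]
    have len1 : l₁.length = i := by simp [hl₁]; omega
    have len2 : l₂.length = j - i := by simp [hl₂]; omega
    have len3 : l₃.length = l.length - j := by simp [hl₃]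
    have c2 : playHist (playHist h l₁) l₂ = playHist h l₁ := by
      rw [← playHist_append, ← hlj, ← heq]
    have c13 : playHist h (l₁ ++ l₃) = h := by
      rw [playHist_append]
      rw [hl123, playHist_append, playHist_append, c2] at hl
      exact hl
    have b2 := ih l₂.length (by omega) l₂ _ c2 rfl
    have b13 := ih (l₁ ++ l₃).length (by simp; omega) (l₁ ++ l₃) _ c13 rfl
    have hsum : playReward r h l = playReward r h (l₁ ++ l₃) + playReward r (playHist h l₁) l₂ := by
      conv_lhs => rw [hl123]
      rw [playReward_append, playReward_append, playReward_append, playHist_append, c2]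
      ring
    have hlen : (l.length : ℝ) = (l₁ ++ l₃).length + l₂.length := by
      have : l.length = (l₁ ++ l₃).length + l₂.length := by simp; omega
      exact_mod_cast this
    rw [hsum, hlen]
    linarith

/-- Replaying the `Δ` entries of the initial history closes the walk, and these extra rewards are
nonnegative. -/
theorem playReward_le_of_avg {r : RTable E Δ} (hr : ∀ e j, 0 ≤ r e j) (h₀ : History G a b Δ)
    (ρ : ℝ) (hρ : ∀ (π : Policy G a b Δ) (ρ' : ℝ), HasAvgReward r π h₀ ρ' → ρ' ≤ ρ)
    (l : List (STPath G a b)) (h : History G a b Δ) :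
    playReward r h l ≤ (l.length + Δ) * ρ := by
  have h1 := playReward_le_of_closed r h₀ ρ hρ (l ++ List.ofFn h) h
    (by rw [playHist_append, playHist_ofFn])
  rw [playReward_append] at h1
  have h2 := playReward_nonneg hr (List.ofFn h) (playHist h l)
  simp only [List.length_append, List.length_ofFn, Nat.cast_add] at h1
  linarith

/-- A gain-optimal policy without detour loses at most `2 Δ ρ` against its gain in any number of
rounds. -/
theorem mul_sub_policyReward_le {r : RTable E Δ} (hr : ∀ e j, 0 ≤ r e j) {h₀ : History G a b Δ}
    {ρ : ℝ} (hρ : ∀ (π : Policy G a b Δ) (ρ' : ℝ), HasAvgReward r π h₀ ρ' → ρ' ≤ ρ)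
    {π : Policy G a b Δ} (hπ : HasAvgReward r π h₀ ρ)
    (hper : (policyStep π)^[Δ] h₀ ∈ Function.periodicPts (policyStep π)) (n : ℕ) :
    n * ρ - policyReward r π h₀ n ≤ 2 * Δ * ρ := by
  have hρ0 : 0 ≤ ρ := ge_of_tendsto' hπ fun n =>
    div_nonneg (policyReward_nonneg hr _ _ _) (Nat.cast_nonneg _)
  obtain ⟨m, hm, hms⟩ := hper
  set s := (policyStep π)^[Δ] h₀ with hs
  change (policyStep π)^[m] s = s at hms
  have hcyc : ∀ q, (policyStep π)^[q * m] s = s := by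
    intro q
    rw [Nat.mul_comm, Function.iterate_mul]
    exact Function.iterate_fixed hms q
  -- Over whole periods the reward is exactly the length times the gain, by uniqueness of the limit.
  have hexact : ∀ q, 0 < q → policyReward r π s (q * m) = (q * m : ℕ) * ρ := by
    intro q hq
    have hqm : 0 < q * m := Nat.mul_pos hq hm
    have h1 := hasAvgReward_of_iterate_eq r π s hqm (hcyc q)
    have h2 : HasAvgReward r π s ρ := (hasAvgReward_iterate r π h₀ Δ ρ).2 hπ
    have h3 := tendsto_nhds_unique h2 h1
    rw [h3]
    field_simp
  have hmid : ∀ k : ℕ, k * ρ - policyReward r π s k ≤ Δ * ρ := by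
    intro k
    -- The `k` rounds are completed to `k + 1` periods, enough since `m ≥ 1`. The completion earns
    -- at most `(N + Δ)ρ`, so the first `k` rounds earn at least `(k - Δ)ρ`.
    obtain ⟨N, hN⟩ : ∃ N, (k + 1) * m = k + N := ⟨(k + 1) * m - k, by
      have : k + 1 ≤ (k + 1) * m := Nat.le_mul_of_pos_right _ hm
      omega⟩
    set x := (policyStep π)^[k] s with hx
    have hclose : playHist x (policyPaths π x N ++ List.ofFn x) = x := by
      rw [playHist_append, playHist_ofFn]
    have h1 := playReward_le_of_closed r h₀ ρ hρ _ x hclose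
    rw [playReward_append, playReward_policyPaths] at h1
    have h2 := playReward_nonneg hr (List.ofFn x) (playHist x (policyPaths π x N))
    have h3 := hexact (k + 1) (Nat.succ_pos k)
    rw [hN, policyReward_add, ← hx] at h3
    simp only [List.length_append, List.length_ofFn, length_policyPaths, Nat.cast_add] at h1 h3
    nlinarith
  rcases le_total n Δ with hle | hle
  · have h1 := policyReward_nonneg hr π h₀ n
    have h2 : (n : ℝ) * ρ ≤ Δ * ρ := mul_le_mul_of_nonneg_right (by exact_mod_cast hle) hρ0
    have h3 : 0 ≤ (Δ : ℝ) * ρ := by positivity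
    linarith
  · obtain ⟨k, rfl⟩ := Nat.exists_eq_add_of_le hle
    have h1 := hmid k
    have h2 := policyReward_nonneg hr π h₀ Δ
    rw [policyReward_add, ← hs]
    push_cast
    linarith

/-- Pigeonhole on the finitely many histories. The cycle does not depend on `r`, which makes the
gain a fixed finite expression in the table and hence measurable in it. -/
theorem exists_hasAvgReward (π : Policy G a b Δ) (h : History G a b Δ) :
    ∃ (k n : ℕ), 0 < n ∧
      (policyStep π)^[n] ((policyStep π)^[k] h) = (policyStep π)^[k] h ∧
      ∀ r : RTable E Δ,
      HasAvgReward r π h (policyReward r π ((policyStep π)^[k] h) n / n) := by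
  obtain ⟨i, j, hij, heq⟩ := Finite.exists_ne_map_eq_of_infinite
    (fun i : ℕ => (policyStep π)^[i] h)
  wlog hlt : i < j generalizing i j
  · exact this j i hij.symm heq.symm (by omega)
  have hcyc : (policyStep π)^[j - i] ((policyStep π)^[i] h) = (policyStep π)^[i] h := by
    rw [← Function.iterate_add_apply, Nat.sub_add_cancel hlt.le]
    exact heq.symm
  refine ⟨i, j - i, by omega, hcyc, fun r => ?_⟩
  rw [← hasAvgReward_iterate r π h i]
  exact hasAvgReward_of_iterate_eq r π _ (by omega) hcyc

end Dynamics

/-! ### Existence of a measurable optimistic planner -/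

section PlannerExistence

variable {V : Type*} {E : Type*} [Fintype E] [DecidableEq E]
variable {G : RGraph V E} {a b : V} {Δ : ℕ}

theorem HasAvgReward.unique {r : RTable E Δ} {π : Policy G a b Δ} {h : History G a b Δ}
    {ρ ρ' : ℝ} (h₁ : HasAvgReward r π h ρ) (h₂ : HasAvgReward r π h ρ') : ρ = ρ' :=
  tendsto_nhds_unique h₁ h₂

theorem policyReward_mono {r r' : RTable E Δ} (hrr : ∀ e j, r e j ≤ r' e j)
    (π : Policy G a b Δ) (h : History G a b Δ) (n : ℕ) :
    policyReward r π h n ≤ policyReward r' π h n :=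
  Finset.sum_le_sum fun _ _ => Finset.sum_le_sum fun _ _ => hrr _ _

theorem HasAvgReward.mono {r r' : RTable E Δ} (hrr : ∀ e j, r e j ≤ r' e j)
    {π : Policy G a b Δ} {h : History G a b Δ} {ρ ρ' : ℝ}
    (h₁ : HasAvgReward r π h ρ) (h₂ : HasAvgReward r' π h ρ') : ρ ≤ ρ' :=
  le_of_tendsto_of_tendsto' h₁ h₂ fun n =>
    div_le_div_of_nonneg_right (policyReward_mono hrr π h n) (Nat.cast_nonneg _)

/-- The half-width of the confidence interval of a pair which was observed `n` times. -/
noncomputable def width (E : Type*) [Fintype E] (κ δ : ℝ) (L Δ t₀ n : ℕ) : ℝ :=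
  κ * √(Real.log ((L * Fintype.card E * Δ * t₀ : ℝ) / δ) / ((max 1 n : ℕ) : ℝ))

/-- The largest table in the set of feasible rewards. -/
noncomputable def upperTable (κ δ : ℝ) (L t₀ : ℕ) (N : CTable E Δ) (rhat : RTable E Δ) : RTable E Δ :=
  fun e j => min 1 (rhat e j + width E κ δ L Δ t₀ (N e j))

theorem le_upperTable {κ δ : ℝ} {L t₀ : ℕ} {N : CTable E Δ} {rhat r : RTable E Δ}
    (hr : r ∈ feasible κ δ L t₀ N rhat) (e : E) (j : Fin (Δ + 1)) :
    r e j ≤ upperTable κ δ L t₀ N rhat e j := by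
  obtain ⟨h1, h2⟩ := hr e j
  refine le_min h1.2 ?_
  have := (abs_le.1 h2).2
  unfold width
  linarith

/-- The feasible set is a box and gains are monotone in the table, so joint maximization over
policies and tables reduces to the upper corner of the box. -/
theorem upperTable_mem_feasible {κ δ : ℝ} {L t₀ : ℕ} {N : CTable E Δ} {rhat : RTable E Δ}
    (hne : (feasible κ δ L t₀ N rhat).Nonempty) :
    upperTable κ δ L t₀ N rhat ∈ feasible κ δ L t₀ N rhat := by
  obtain ⟨r, hr⟩ := hne
  intro e j
  have h0 := le_upperTable hr e j
  obtain ⟨h1, h2⟩ := hr e j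
  have h3 := abs_le.1 h2
  refine ⟨⟨h1.1.trans h0, min_le_left _ _⟩, abs_le.2 ⟨by linarith, ?_⟩⟩
  have : upperTable κ δ L t₀ N rhat e j ≤ rhat e j + width E κ δ L Δ t₀ (N e j) :=
    min_le_right _ _
  unfold width at this
  linarith

/-- The long-run average reward of a policy. -/
noncomputable def avgReward (r : RTable E Δ) (π : Policy G a b Δ) (h : History G a b Δ) : ℝ :=
  policyReward r π ((policyStep π)^[(exists_hasAvgReward π h).choose] h)
    (exists_hasAvgReward π h).choose_spec.choose /
    (exists_hasAvgReward π h).choose_spec.choose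

theorem hasAvgReward_avgReward (r : RTable E Δ) (π : Policy G a b Δ) (h : History G a b Δ) :
    HasAvgReward r π h (avgReward r π h) :=
  (exists_hasAvgReward π h).choose_spec.choose_spec.2.2 r

/-- The policies without detour whose long-run average reward is maximal. -/
def bestPolicies (r : RTable E Δ) (h : History G a b Δ) : Set (Policy G a b Δ) :=
  {π | (policyStep π)^[Δ] h ∈ Function.periodicPts (policyStep π) ∧
    ∀ π' : Policy G a b Δ, avgReward r π' h ≤ avgReward r π h}

/-- A gain-optimal policy exists by finiteness; rerouting it straight to its own cycle removes the
detour and keeps the gain. -/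
theorem bestPolicies_nonempty [Nonempty (STPath G a b)] (r : RTable E Δ)
    (h : History G a b Δ) : (bestPolicies r h).Nonempty := by
  obtain ⟨π₀, hπ₀⟩ := Finite.exists_max fun π : Policy G a b Δ => avgReward r π h
  obtain ⟨k, n, hn, hcyc, hav⟩ := exists_hasAvgReward π₀ h
  obtain ⟨π, hper, hπ⟩ := exists_policy_reaching_cycle π₀ _ h hn hcyc
  refine ⟨π, hper, fun π' => (hπ₀ π').trans_eq ?_⟩
  rw [(hasAvgReward_avgReward r π₀ h).unique (hav r),
    (hasAvgReward_avgReward r π h).unique (hπ r)]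

/-- A planner that selects one of the best policies for the largest feasible table. -/
noncomputable def optimisticPlanner [Nonempty (STPath G a b)] (κ δ : ℝ) (L : ℕ) : Planner G a b Δ :=
  fun t₀ N rhat h => Classical.epsilon (· ∈ bestPolicies (upperTable κ δ L t₀ N rhat) h)

theorem measurable_avgReward_upperTable (κ δ : ℝ) (L t₀ : ℕ) (N : CTable E Δ)
    (π : Policy G a b Δ) (h : History G a b Δ) :
    Measurable fun rhat : RTable E Δ => avgReward (upperTable κ δ L t₀ N rhat) π h := by
  unfold avgReward policyReward pathReward upperTable
  refine Measurable.div_const ?_ _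
  refine Finset.measurable_sum _ fun k _ => Finset.measurable_sum _ fun e _ => ?_
  refine measurable_const.min (Measurable.add_const ?_ _)
  exact (measurable_pi_apply _).comp (measurable_pi_apply e)

theorem isOptimisticPlanner_optimisticPlanner [Nonempty (STPath G a b)] (κ δ : ℝ) (L : ℕ) :
    IsOptimisticPlanner κ δ L (optimisticPlanner κ δ L : Planner G a b Δ) where
  optimistic t₀ N rhat h hne := by
    obtain ⟨hper, hmax⟩ : optimisticPlanner κ δ L t₀ N rhat h ∈
        bestPolicies (upperTable κ δ L t₀ N rhat) h :=
      Classical.epsilon_spec (bestPolicies_nonempty (upperTable κ δ L t₀ N rhat) h)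
    refine ⟨⟨_, upperTable_mem_feasible hne, _, hasAvgReward_avgReward _ _ _, ?_⟩, hper⟩
    intro r' hr' π' ρ' hρ'
    exact (hρ'.mono (le_upperTable hr') (hasAvgReward_avgReward _ _ _)).trans (hmax π')
  measurable t₀ N h π := by
    have h1 : Measurable fun rhat : RTable E Δ =>
        bestPolicies (G := G) (a := a) (b := b) (upperTable κ δ L t₀ N rhat) h := by
      rw [measurable_set_iff]
      intro π'
      refine measurable_to_prop ?_
      have : (fun rhat : RTable E Δ => π' ∈ bestPolicies (upperTable κ δ L t₀ N rhat) h) ⁻¹'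
          {True} = {rhat | (policyStep π')^[Δ] h ∈ Function.periodicPts (policyStep π')} ∩
            ⋂ π'' : Policy G a b Δ, {rhat | avgReward (upperTable κ δ L t₀ N rhat) π'' h ≤
              avgReward (upperTable κ δ L t₀ N rhat) π' h} := by
        ext rhat
        simp [bestPolicies]
      rw [this]
      refine (MeasurableSet.const _).inter (MeasurableSet.iInter fun π'' => ?_)
      exact measurableSet_le (measurable_avgReward_upperTable κ δ L t₀ N π'' h)
        (measurable_avgReward_upperTable κ δ L t₀ N π' h)
    -- The choice depends on `rhat` only through the set of best policies, which takes finitely many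
    -- values.
    exact h1 (Set.toFinite {S : Set (Policy G a b Δ) |
      Classical.epsilon (· ∈ S) = π}).measurableSet

end PlannerExistence

/-! ### Exponential supermartingale and tail bounds for the noise -/

section Concentration

variable {E : Type*} [Fintype E] [DecidableEq E]
variable {Ω : Type*} [mΩ : MeasurableSpace Ω] {P : Measure Ω} [IsProbabilityMeasure P]
variable {ε : ℕ → E → Ω → ℝ}

/-- The information in the noise of the first `k` rounds. -/
abbrev noisePast (ε : ℕ → E → Ω → ℝ) (k : ℕ) : MeasurableSpace Ω :=
  ⨆ i ∈ Set.Iio k, MeasurableSpace.comap (fun ω e => ε i e ω) inferInstance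

theorem noisePast_mono (ε : ℕ → E → Ω → ℝ) {i k : ℕ} (h : i ≤ k) :
    noisePast ε i ≤ noisePast ε k :=
  biSup_mono fun _ hj => lt_of_lt_of_le hj h

theorem noisePast_le (hm : ∀ k e, Measurable (ε k e)) (k : ℕ) : noisePast ε k ≤ mΩ :=
  iSup₂_le fun i _ => (measurable_pi_lambda _ fun e => hm i e).comap_le

theorem measurable_noise_noisePast (ε : ℕ → E → Ω → ℝ) {i k : ℕ} (h : i < k) :
    Measurable[noisePast ε k] fun ω e => ε i e ω := by
  refine Measurable.mono (comap_measurable _) ?_ le_rfl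
  exact le_iSup₂_of_le i h le_rfl

theorem indep_noisePast (hm : ∀ k e, Measurable (ε k e))
    (hi : iIndepFun (fun (k : ℕ) (ω : Ω) (e : E) => ε k e ω) P) (k : ℕ) :
    Indep (noisePast ε k) (MeasurableSpace.comap (fun ω e => ε k e ω) inferInstance) P := by
  have h := indep_iSup_of_disjoint (S := Set.Iio k) (T := {k})
    (fun i => (measurable_pi_lambda _ fun e => hm i e : Measurable fun ω e => ε i e ω).comap_le)
    hi (by simp)
  simpa [noisePast] using h

/-- The exponential weight of the edges in `S` when their noise is `x`. -/
noncomputable def expWeight (c : ℝ) (S : Finset E) (x : E → ℝ) : ENNReal :=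
  ENNReal.ofReal (Real.exp (c * ∑ e ∈ S, x e - c ^ 2 / 2 * (S.card : ℝ) ^ 2))

theorem measurable_expWeight (c : ℝ) (S : Finset E) : Measurable (expWeight c S) := by
  unfold expWeight
  refine ENNReal.measurable_ofReal.comp (Real.measurable_exp.comp ?_)
  refine Measurable.sub_const (Measurable.const_mul ?_ _) _
  exact Finset.measurable_sum _ fun e _ => measurable_pi_apply e

theorem lintegral_exp_gaussian {X : Ω → ℝ} (hX : Measurable X)
    (hg : P.map X = gaussianReal 0 1) (t : ℝ) :
    ∫⁻ ω, ENNReal.ofReal (Real.exp (t * X ω)) ∂P = ENNReal.ofReal (Real.exp (t ^ 2 / 2)) := by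
  have h1 : ∫⁻ ω, ENNReal.ofReal (Real.exp (t * X ω)) ∂P =
      ∫⁻ x, ENNReal.ofReal (Real.exp (t * x)) ∂(P.map X) := by
    rw [lintegral_map (by fun_prop) hX]
  have h2 := mgf_gaussianReal (p := gaussianReal 0 1) (X := id) (μ := 0) (v := 1) (by simp) t
  rw [h1, hg, ← ofReal_integral_eq_lintegral_ofReal (integrable_exp_mul_gaussianReal t)
    (Eventually.of_forall fun _ => (Real.exp_pos _).le)]
  simp only [mgf, id] at h2
  rw [h2]
  simp

/-- The noise of a fixed set of edges in one round is sub-Gaussian, whatever the dependence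
among the edges. -/
theorem lintegral_expWeight_le (hm : ∀ k e, Measurable (ε k e))
    (hg : ∀ k e, P.map (ε k e) = gaussianReal 0 1) (k : ℕ) (c : ℝ) (S : Finset E) :
    ∫⁻ ω, expWeight c S (fun e => ε k e ω) ∂P ≤ 1 := by
  rcases S.eq_empty_or_nonempty with rfl | hS
  · simp [expWeight]
  have hn : 0 < (S.card : ℝ) := by exact_mod_cast hS.card_pos
  set n : ℝ := (S.card : ℝ) with hndef
  -- Jensen with uniform weights needs only the marginal laws of the noise; the price is the
  -- variance proxy `n ^ 2` in place of `n`.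
  have hconv : ∀ x : E → ℝ, Real.exp (c * ∑ e ∈ S, x e) ≤
      ∑ e ∈ S, n⁻¹ * Real.exp (c * n * x e) := by
    intro x
    have := convexOn_exp.map_sum_le (t := S) (w := fun _ => n⁻¹) (p := fun e => c * n * x e)
      (fun _ _ => by positivity) (by simp [← hndef, hn.ne']) (fun _ _ => Set.mem_univ _)
    simp only [smul_eq_mul] at this
    refine le_trans (le_of_eq ?_) this
    congr 1
    rw [Finset.mul_sum]
    refine Finset.sum_congr rfl fun e _ => ?_
    field_simp
  have hpt : ∀ x : E → ℝ, expWeight c S x ≤ ENNReal.ofReal (Real.exp (-(c * n) ^ 2 / 2)) *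
      ∑ e ∈ S, ENNReal.ofReal n⁻¹ * ENNReal.ofReal (Real.exp (c * n * x e)) := by
    intro x
    have h1 : ∑ e ∈ S, ENNReal.ofReal n⁻¹ * ENNReal.ofReal (Real.exp (c * n * x e)) =
        ENNReal.ofReal (∑ e ∈ S, n⁻¹ * Real.exp (c * n * x e)) := by
      rw [ENNReal.ofReal_sum_of_nonneg fun _ _ => by positivity]
      exact Finset.sum_congr rfl fun e _ => (ENNReal.ofReal_mul (by positivity)).symm
    rw [h1, ← ENNReal.ofReal_mul (Real.exp_pos _).le, expWeight]
    apply ENNReal.ofReal_le_ofReal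
    rw [sub_eq_add_neg, Real.exp_add, mul_comm]
    refine mul_le_mul (le_of_eq ?_) (hconv x) (Real.exp_pos _).le (Real.exp_pos _).le
    congr 1
    ring
  refine (lintegral_mono fun ω => hpt _).trans ?_
  have hmeas : ∀ e, Measurable fun ω => ENNReal.ofReal (Real.exp (c * n * ε k e ω)) := fun e =>
    ENNReal.measurable_ofReal.comp (Real.measurable_exp.comp ((hm k e).const_mul _))
  rw [lintegral_const_mul _ (Finset.measurable_sum _ fun e _ => (hmeas e).const_mul _),
    lintegral_finsetSum _ fun e _ => (hmeas e).const_mul _]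
  have h2 : ∀ e ∈ S, ∫⁻ ω, ENNReal.ofReal n⁻¹ * ENNReal.ofReal (Real.exp (c * n * ε k e ω)) ∂P =
      ENNReal.ofReal (n⁻¹ * Real.exp ((c * n) ^ 2 / 2)) := fun e _ => by
    rw [lintegral_const_mul _ (hmeas e), lintegral_exp_gaussian (hm k e) (hg k e),
      ENNReal.ofReal_mul (by positivity)]
  rw [Finset.sum_congr rfl h2, Finset.sum_const, nsmul_eq_mul, ← ENNReal.ofReal_natCast,
    ← ENNReal.ofReal_mul (by positivity), ← ENNReal.ofReal_mul (Real.exp_pos _).le, ← hndef]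
  rw [ENNReal.ofReal_le_one, mul_inv_cancel_left₀ hn.ne', ← Real.exp_add]
  apply le_of_eq
  rw [Real.exp_eq_one_iff]
  ring

/-- The sum of the noise of the edges in `A i ω` over the rounds `i < k`. -/
def noiseSum (ε : ℕ → E → Ω → ℝ) (A : ℕ → Ω → Finset E) (k : ℕ) (ω : Ω) : ℝ :=
  ∑ i ∈ Finset.range k, ∑ e ∈ A i ω, ε i e ω

/-- The variance proxy of `noiseSum`. -/
def noiseVar (A : ℕ → Ω → Finset E) (k : ℕ) (ω : Ω) : ℝ :=
  ∑ i ∈ Finset.range k, ((A i ω).card : ℝ) ^ 2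

theorem expWeight_eq_sum (c : ℝ) (A : Ω → Finset E) (x : Ω → E → ℝ) (ω : Ω) :
    expWeight c (A ω) (x ω) =
      ∑ S : Finset E, ({ω | A ω = S}.indicator 1 ω : ENNReal) * expWeight c S (x ω) := by
  rw [Finset.sum_eq_single (A ω)]
  · simp
  · intro S _ hS
    simp [Ne.symm hS]
  · simp

theorem measurable_prod_expWeight {A : ℕ → Ω → Finset E}
    (hA : ∀ k S, MeasurableSet[noisePast ε k] {ω | A k ω = S}) (c : ℝ) (k : ℕ) :
    Measurable[noisePast ε k] fun ω =>
      ∏ i ∈ Finset.range k, expWeight c (A i ω) fun e => ε i e ω := by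
  refine Finset.measurable_prod _ fun i hi => ?_
  have hik := Finset.mem_range.1 hi
  simp only [expWeight_eq_sum c (A i) (fun ω e => ε i e ω)]
  refine Finset.measurable_sum _ fun S _ => Measurable.mul ?_ ?_
  · exact Measurable.indicator (@measurable_const _ _ _ (noisePast ε k) 1) (noisePast_mono ε hik.le _ (hA i S))
  · exact (measurable_expWeight c S).comp (measurable_noise_noisePast ε hik)

/-- On each event `A k = S`, which belongs to the past, the last factor is that of a fixed set,
independent of the past and of mean at most one. Summing over the finitely many `S` replaces
conditional expectations. -/
theorem lintegral_prod_expWeight_le (hm : ∀ k e, Measurable (ε k e))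
    (hg : ∀ k e, P.map (ε k e) = gaussianReal 0 1)
    (hi : iIndepFun (fun (k : ℕ) (ω : Ω) (e : E) => ε k e ω) P) {A : ℕ → Ω → Finset E}
    (hA : ∀ k S, MeasurableSet[noisePast ε k] {ω | A k ω = S}) (c : ℝ) (k : ℕ) :
    ∫⁻ ω, ∏ i ∈ Finset.range k, expWeight c (A i ω) (fun e => ε i e ω) ∂P ≤ 1 := by
  induction k with
  | zero => simp
  | succ k ih =>
    refine le_trans ?_ ih
    set Z : Ω → ENNReal := fun ω =>
      ∏ i ∈ Finset.range k, expWeight c (A i ω) fun e => ε i e ω with hZ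
    have hZm : Measurable[noisePast ε k] Z := measurable_prod_expWeight hA c k
    have hind : ∀ S, Measurable[noisePast ε k] fun ω =>
        Z ω * ({ω | A k ω = S}.indicator 1 ω : ENNReal) := fun S =>
      Measurable.mul hZm (Measurable.indicator (@measurable_const _ _ _ (noisePast ε k) 1) (hA k S))
    have hle := noisePast_le hm k
    have hind' : ∀ S, Measurable fun ω =>
        Z ω * ({ω | A k ω = S}.indicator 1 ω : ENNReal) := fun S => (hind S).mono hle le_rfl
    have hkm : Measurable fun ω e => ε k e ω := measurable_pi_lambda _ fun e => hm k e
    have h1 : ∀ ω, ∏ i ∈ Finset.range (k + 1), expWeight c (A i ω) (fun e => ε i e ω) =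
        ∑ S : Finset E, Z ω * ({ω | A k ω = S}.indicator 1 ω : ENNReal) *
          expWeight c S (fun e => ε k e ω) := fun ω => by
      rw [Finset.prod_range_succ, expWeight_eq_sum c (A k) (fun ω e => ε k e ω), Finset.mul_sum]
      exact Finset.sum_congr rfl fun S _ => (mul_assoc _ _ _).symm
    have h2 : ∀ ω, Z ω = ∑ S : Finset E, Z ω * ({ω | A k ω = S}.indicator 1 ω : ENNReal) := by
      intro ω
      rw [← Finset.mul_sum, Finset.sum_eq_single (A k ω)]
      · simp
      · intro S _ hS
        simp [Ne.symm hS]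
      · simp
    calc _ = ∑ S : Finset E, ∫⁻ ω, Z ω * ({ω | A k ω = S}.indicator 1 ω : ENNReal) *
          expWeight c S (fun e => ε k e ω) ∂P := by
            rw [lintegral_congr h1, lintegral_finsetSum]
            exact fun S _ => (hind' S).mul ((measurable_expWeight c S).comp hkm)
      _ = ∑ S : Finset E, (∫⁻ ω, Z ω * ({ω | A k ω = S}.indicator 1 ω : ENNReal) ∂P) *
          ∫⁻ ω, expWeight c S (fun e => ε k e ω) ∂P := by
            refine Finset.sum_congr rfl fun S _ => ?_
            exact lintegral_mul_eq_lintegral_mul_lintegral_of_independent_measurableSpace hle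
              hkm.comap_le (indep_noisePast hm hi k) (hind S)
              ((measurable_expWeight c S).comp (comap_measurable _))
      _ ≤ ∑ S : Finset E, (∫⁻ ω, Z ω * ({ω | A k ω = S}.indicator 1 ω : ENNReal) ∂P) := by
            refine Finset.sum_le_sum fun S _ => ?_
            exact mul_le_of_le_one_right' (lintegral_expWeight_le hm hg k c S)
      _ = ∫⁻ ω, Z ω ∂P := by
            rw [lintegral_congr h2, lintegral_finsetSum]
            exact fun S _ => hind' S

theorem measure_noiseSum_ge_le (hm : ∀ k e, Measurable (ε k e))
    (hg : ∀ k e, P.map (ε k e) = gaussianReal 0 1)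
    (hi : iIndepFun (fun (k : ℕ) (ω : Ω) (e : E) => ε k e ω) P) {A : ℕ → Ω → Finset E}
    (hA : ∀ k S, MeasurableSet[noisePast ε k] {ω | A k ω = S}) (k : ℕ) {s : ℝ}
    (hs : s ^ 2 = 1) (x : ℝ) {v : ℝ} (hv : 0 < v) :
    P {ω | |x| ≤ s * noiseSum ε A k ω ∧ noiseVar A k ω ≤ v} ≤
      ENNReal.ofReal (Real.exp (-(x ^ 2 / (2 * v)))) := by
  -- This rate maximizes the Chernoff exponent `|c| |x| - c ^ 2 v / 2`; the sign `s` selects the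
  -- tail.
  set c : ℝ := s * |x| / v with hc
  have hZm : Measurable fun ω => ∏ i ∈ Finset.range k, expWeight c (A i ω) fun e => ε i e ω :=
    (measurable_prod_expWeight hA c k).mono (noisePast_le hm k) le_rfl
  have hprod : ∀ ω, ∏ i ∈ Finset.range k, expWeight c (A i ω) (fun e => ε i e ω) =
      ENNReal.ofReal (Real.exp (c * noiseSum ε A k ω - c ^ 2 / 2 * noiseVar A k ω)) := by
    intro ω
    unfold expWeight noiseSum noiseVar
    rw [← ENNReal.ofReal_prod_of_nonneg fun _ _ => (Real.exp_pos _).le, ← Real.exp_sum,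
      Finset.sum_sub_distrib, Finset.mul_sum, Finset.mul_sum]
  have hmarkov := mul_meas_ge_le_lintegral (μ := P) hZm
    (ENNReal.ofReal (Real.exp (x ^ 2 / (2 * v))))
  have hbound := hmarkov.trans (lintegral_prod_expWeight_le hm hg hi hA c k)
  have hsub : {ω | |x| ≤ s * noiseSum ε A k ω ∧ noiseVar A k ω ≤ v} ⊆
      {ω | ENNReal.ofReal (Real.exp (x ^ 2 / (2 * v))) ≤
        ∏ i ∈ Finset.range k, expWeight c (A i ω) fun e => ε i e ω} := by
    rintro ω ⟨h1, h2⟩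
    rw [Set.mem_ofPred_eq, hprod]
    apply ENNReal.ofReal_le_ofReal
    apply Real.exp_le_exp.2
    have e1 : c * noiseSum ε A k ω = |x| / v * (s * noiseSum ε A k ω) := by rw [hc]; ring
    have e2 : c ^ 2 = x ^ 2 / v ^ 2 := by
      rw [hc, div_pow, mul_pow, hs, sq_abs, one_mul]
    have e3 : |x| / v * |x| ≤ |x| / v * (s * noiseSum ε A k ω) :=
      mul_le_mul_of_nonneg_left h1 (by positivity)
    have e4 : x ^ 2 / v ^ 2 / 2 * noiseVar A k ω ≤ x ^ 2 / v ^ 2 / 2 * v :=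
      mul_le_mul_of_nonneg_left h2 (by positivity)
    have e5 : |x| / v * |x| - x ^ 2 / v ^ 2 / 2 * v = x ^ 2 / (2 * v) := by
      rw [div_mul_eq_mul_div, abs_mul_abs_self]
      field_simp
      ring
    rw [e1, e2]
    linarith
  have hpos := Real.exp_pos (x ^ 2 / (2 * v))
  rw [Real.exp_neg, ENNReal.ofReal_inv_of_pos hpos, ENNReal.le_inv_iff_mul_le, mul_comm]
  exact (mul_le_mul_right (measure_mono hsub) _).trans hbound

end Concentration

/-! ### Measurability of the learner's memory -/

section LearnerMeasurability

variable {V : Type*} {E : Type*} [Fintype E] [DecidableEq E]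
variable {G : RGraph V E} {a b : V} {Δ : ℕ} {Ω : Type*} [MeasurableSpace Ω]

instance STPath.instMeasurableSpace : MeasurableSpace (STPath G a b) := ⊤

instance STPath.instDiscreteMeasurableSpace : DiscreteMeasurableSpace (STPath G a b) :=
  ⟨fun _ => trivial⟩

/-- All entries of a random memory of the learner are measurable. -/
structure MeasurableState (S : Ω → LearnerState G a b Δ) : Prop where
  round : Measurable fun ω => (S ω).round
  hist : Measurable fun ω => (S ω).hist
  prior : Measurable fun ω => (S ω).prior
  cur : Measurable fun ω => (S ω).cur
  rewardSum : Measurable fun ω => (S ω).rewardSum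
  policy : Measurable fun ω => (S ω).policy

theorem MeasurableState.histPolicy {S : Ω → LearnerState G a b Δ} (hS : MeasurableState S)
    (p : History G a b Δ → Policy G a b Δ → Prop) :
    MeasurableSet {ω | p (S ω).hist (S ω).policy} :=
  (hS.hist.prodMk hS.policy)
    (Set.toFinite {x : History G a b Δ × Policy G a b Δ | p x.1 x.2}).measurableSet

theorem MeasurableState.record {S : Ω → LearnerState G a b Δ} (hS : MeasurableState S)
    {y : Ω → E → ℝ} (hy : ∀ e, Measurable fun ω => y ω e) :
    MeasurableState fun ω => (S ω).record (y ω) where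
  round := (Measurable.of_discrete (f := fun n : ℕ => n + 1)).comp hS.round
  hist := (Measurable.of_discrete
    (f := fun x : History G a b Δ × Policy G a b Δ => push x.1 (x.2 x.1))).comp
    (hS.hist.prodMk hS.policy)
  prior := hS.prior
  cur := by
    refine measurable_pi_lambda _ fun e => measurable_pi_lambda _ fun j => ?_
    have h : Measurable fun ω => (S ω).cur e j :=
      (measurable_pi_apply j).comp ((measurable_pi_apply e).comp hS.cur)
    exact Measurable.ite (hS.histPolicy fun h π => e ∈ (π h).edgeSet ∧ useCount h e = j)
      (h.add_const 1) h
  rewardSum := by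
    refine measurable_pi_lambda _ fun e => measurable_pi_lambda _ fun j => ?_
    have h : Measurable fun ω => (S ω).rewardSum e j :=
      (measurable_pi_apply j).comp ((measurable_pi_apply e).comp hS.rewardSum)
    exact Measurable.ite (hS.histPolicy fun h π => e ∈ (π h).edgeSet ∧ useCount h e = j)
      (h.add (hy e)) h
  policy := hS.policy

theorem MeasurableState.newEpisode {plan : Planner G a b Δ}
    (hplan : ∀ (t₀ : ℕ) (N : CTable E Δ) (h : History G a b Δ) (π : Policy G a b Δ),
      MeasurableSet {rhat : RTable E Δ | plan t₀ N rhat h = π})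
    {S : Ω → LearnerState G a b Δ} (hS : MeasurableState S) :
    MeasurableState fun ω => (S ω).newEpisode plan := by
  have hN : Measurable fun ω => fun (e : E) (j : Fin (Δ + 1)) =>
      (S ω).prior e j + (S ω).cur e j := by
    refine measurable_pi_lambda _ fun e => measurable_pi_lambda _ fun j => ?_
    exact ((measurable_pi_apply j).comp ((measurable_pi_apply e).comp hS.prior)).add
      ((measurable_pi_apply j).comp ((measurable_pi_apply e).comp hS.cur))
  refine ⟨hS.round, hS.hist, hN, measurable_const, hS.rewardSum, ?_⟩
  have hrhat : Measurable fun ω => fun (e : E) (j : Fin (Δ + 1)) =>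
      (S ω).rewardSum e j / ((max 1 ((S ω).prior e j + (S ω).cur e j) : ℕ) : ℝ) := by
    refine measurable_pi_lambda _ fun e => measurable_pi_lambda _ fun j => ?_
    refine ((measurable_pi_apply j).comp ((measurable_pi_apply e).comp hS.rewardSum)).div ?_
    exact (Measurable.of_discrete (f := fun n : ℕ => ((max 1 n : ℕ) : ℝ))).comp
      ((measurable_pi_apply j).comp ((measurable_pi_apply e).comp hN))
  have hQ : Measurable fun x : (ℕ × CTable E Δ × History G a b Δ) × RTable E Δ =>
      plan x.1.1 x.1.2.1 x.2 x.1.2.2 := by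
    -- Round, counts and history range over a countable set, so measurability in `rhat` for each
    -- fixed value of them suffices.
    refine measurable_from_prod_countable_right fun d => ?_
    exact measurable_to_countable' fun π => hplan d.1 d.2.1 d.2.2 π
  exact hQ.comp ((hS.round.prodMk (hN.prodMk hS.hist)).prodMk hrhat)

theorem MeasurableState.ite {p : Ω → Prop} [DecidablePred p] (hp : MeasurableSet {ω | p ω})
    {S S' : Ω → LearnerState G a b Δ} (hS : MeasurableState S) (hS' : MeasurableState S') :
    MeasurableState fun ω => if p ω then S ω else S' ω where
  round := by
    simpa only [apply_ite] using Measurable.ite hp hS.round hS'.round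
  hist := by
    simpa only [apply_ite] using Measurable.ite hp hS.hist hS'.hist
  prior := by
    simpa only [apply_ite] using Measurable.ite hp hS.prior hS'.prior
  cur := by
    simpa only [apply_ite] using Measurable.ite hp hS.cur hS'.cur
  rewardSum := by
    simpa only [apply_ite] using Measurable.ite hp hS.rewardSum hS'.rewardSum
  policy := by
    simpa only [apply_ite] using Measurable.ite hp hS.policy hS'.policy

theorem MeasurableState.next {plan : Planner G a b Δ}
    (hplan : ∀ (t₀ : ℕ) (N : CTable E Δ) (h : History G a b Δ) (π : Policy G a b Δ),
      MeasurableSet {rhat : RTable E Δ | plan t₀ N rhat h = π})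
    {S : Ω → LearnerState G a b Δ} (hS : MeasurableState S)
    {y : Ω → E → ℝ} (hy : ∀ e, Measurable fun ω => y ω e) :
    MeasurableState fun ω => (S ω).next plan (y ω) := by
  have hR := hS.record hy
  unfold LearnerState.next
  refine MeasurableState.ite ?_ hR (hR.newEpisode hplan)
  exact (hR.prior.prodMk hR.cur) (Set.to_countable
    {x : CTable E Δ × CTable E Δ | ∀ e j, x.2 e j < max 1 (x.1 e j)}).measurableSet

theorem measurableState_run {plan : Planner G a b Δ}
    (hplan : ∀ (t₀ : ℕ) (N : CTable E Δ) (h : History G a b Δ) (π : Policy G a b Δ),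
      MeasurableSet {rhat : RTable E Δ | plan t₀ N rhat h = π})
    (h₁ : History G a b Δ) (r : RTable E Δ) {ε : ℕ → E → Ω → ℝ} (k : ℕ)
    (hε : ∀ i < k, ∀ e, Measurable (ε i e)) :
    MeasurableState fun ω => run plan h₁ r (fun i e => ε i e ω) k := by
  induction k with
  | zero =>
    exact ⟨measurable_const, measurable_const, measurable_const, measurable_const,
      measurable_const, measurable_const⟩
  | succ k ih =>
    have hS := ih fun i hi => hε i (by omega)
    refine hS.next hplan fun e => Measurable.add ?_ (hε k (by omega) e)
    exact (Measurable.of_discrete (f := fun h : History G a b Δ => r e (useCount h e))).comp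
      hS.hist

/-- Predictability: history and policy before a round are functions of the earlier noise alone, as
the supermartingale argument requires of the edge sets. -/
theorem measurableSet_run_histPolicy {plan : Planner G a b Δ}
    (hplan : ∀ (t₀ : ℕ) (N : CTable E Δ) (h : History G a b Δ) (π : Policy G a b Δ),
      MeasurableSet {rhat : RTable E Δ | plan t₀ N rhat h = π})
    (h₁ : History G a b Δ) (r : RTable E Δ) (ε : ℕ → E → Ω → ℝ) (k : ℕ)
    (p : History G a b Δ → Policy G a b Δ → Prop) :
    MeasurableSet[noisePast ε k] {ω | p (run plan h₁ r (fun i e => ε i e ω) k).hist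
      (run plan h₁ r (fun i e => ε i e ω) k).policy} := by
  let _ := noisePast ε k
  refine (measurableState_run hplan h₁ r k fun i hi e => ?_).histPolicy p
  exact (measurable_pi_apply e).comp (measurable_noise_noisePast ε hi)

end LearnerMeasurability

/-! ### Bookkeeping of counts, rewards and episodes -/

section Learner

variable {V : Type*} {E : Type*} [Fintype E] [DecidableEq E]
variable {G : RGraph V E} {a b : V} {Δ : ℕ}

/-- The edge `e` if the pair `(e, j)` is observed in the coming round. -/
def LearnerState.observed (S : LearnerState G a b Δ) (e : E) (j : Fin (Δ + 1)) : Finset E :=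
  if e ∈ S.path.edgeSet ∧ useCount S.hist e = j then {e} else ∅

/-- The number of observations in all earlier rounds. -/
def LearnerState.total (S : LearnerState G a b Δ) : CTable E Δ :=
  fun e j => S.prior e j + S.cur e j

/-- The empirical means of all earlier rounds. -/
noncomputable def LearnerState.empirical (S : LearnerState G a b Δ) : RTable E Δ :=
  fun e j => S.rewardSum e j / ((max 1 (S.total e j) : ℕ) : ℝ)

theorem LearnerState.card_observed_le (S : LearnerState G a b Δ) (e : E) (j : Fin (Δ + 1)) :
    (S.observed e j).card ≤ 1 := by
  unfold LearnerState.observed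
  split_ifs <;> simp

/-- A sum along the chosen path becomes a sum over all pairs, which can be charged to the increments
of the counts. -/
theorem LearnerState.sum_path_eq (S : LearnerState G a b Δ) (F : E → Fin (Δ + 1) → ℝ) :
    ∑ e ∈ S.path.edgeSet, F e (useCount S.hist e) =
      ∑ e, ∑ j, ((S.observed e j).card : ℝ) * F e j := by
  have h : ∀ e, ∑ j, ((S.observed e j).card : ℝ) * F e j =
      if e ∈ S.path.edgeSet then F e (useCount S.hist e) else 0 := by
    intro e
    rw [Finset.sum_eq_single (useCount S.hist e)]
    · by_cases he : e ∈ S.path.edgeSet <;> simp [LearnerState.observed, he]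
    · intro j _ hj
      simp [LearnerState.observed, Ne.symm hj]
    · simp
  simp [h]

theorem LearnerState.next_round (plan : Planner G a b Δ) (S : LearnerState G a b Δ)
    (y : E → ℝ) : (S.next plan y).round = S.round + 1 := by
  unfold LearnerState.next
  split_ifs <;> rfl

theorem LearnerState.record_total (S : LearnerState G a b Δ) (y : E → ℝ) (e : E)
    (j : Fin (Δ + 1)) : (S.record y).total e j = S.total e j + (S.observed e j).card := by
  simp only [LearnerState.total, LearnerState.record, LearnerState.observed]
  split_ifs <;> simp [Nat.add_assoc]

theorem LearnerState.next_total (plan : Planner G a b Δ) (S : LearnerState G a b Δ)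
    (y : E → ℝ) (e : E) (j : Fin (Δ + 1)) :
    (S.next plan y).total e j = S.total e j + (S.observed e j).card := by
  rw [← S.record_total y]
  unfold LearnerState.next
  split_ifs <;> simp [LearnerState.newEpisode, LearnerState.total]

theorem LearnerState.next_rewardSum (plan : Planner G a b Δ) (S : LearnerState G a b Δ)
    (y : E → ℝ) (e : E) (j : Fin (Δ + 1)) :
    (S.next plan y).rewardSum e j = S.rewardSum e j + ∑ d ∈ S.observed e j, y d := by
  have : (S.next plan y).rewardSum e j = (S.record y).rewardSum e j := by
    unfold LearnerState.next
    split_ifs <;> rfl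
  rw [this]
  simp only [LearnerState.record, LearnerState.observed]
  split_ifs <;> simp

variable (plan : Planner G a b Δ) (h₁ : History G a b Δ) (r : RTable E Δ) (ε : ℕ → E → ℝ)

theorem run_succ (k : ℕ) : run plan h₁ r ε (k + 1) = (run plan h₁ r ε k).next plan
    fun e => r e (useCount (run plan h₁ r ε k).hist e) + ε k e := rfl

theorem run_round (k : ℕ) : (run plan h₁ r ε k).round = k + 1 := by
  induction k with
  | zero => rfl
  | succ k ih => rw [run_succ, LearnerState.next_round, ih]

theorem run_total (k : ℕ) (e : E) (j : Fin (Δ + 1)) :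
    (run plan h₁ r ε k).total e j =
      ∑ i ∈ Finset.range k, ((run plan h₁ r ε i).observed e j).card := by
  induction k with
  | zero => rfl
  | succ k ih => rw [run_succ, LearnerState.next_total, ih, Finset.sum_range_succ]

theorem run_total_le (k : ℕ) (e : E) (j : Fin (Δ + 1)) :
    (run plan h₁ r ε k).total e j ≤ k := by
  rw [run_total]
  exact (Finset.sum_le_card_nsmul _ _ 1 fun i _ => LearnerState.card_observed_le _ e j).trans
    (by simp)

/-- Separates mean from noise, so the error of an empirical mean is a predictable sum of noise
variables divided by a count. -/
theorem run_rewardSum (k : ℕ) (e : E) (j : Fin (Δ + 1)) :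
    (run plan h₁ r ε k).rewardSum e j = (run plan h₁ r ε k).total e j * r e j +
      ∑ i ∈ Finset.range k, ∑ d ∈ (run plan h₁ r ε i).observed e j, ε i d := by
  induction k with
  | zero => simp [run, LearnerState.first, LearnerState.total]
  | succ k ih =>
    rw [run_succ, LearnerState.next_rewardSum, LearnerState.next_total, ih,
      Finset.sum_range_succ]
    have : ∑ d ∈ (run plan h₁ r ε k).observed e j,
        (r d (useCount (run plan h₁ r ε k).hist d) + ε k d) =
        ((run plan h₁ r ε k).observed e j).card * r e j +
          ∑ d ∈ (run plan h₁ r ε k).observed e j, ε k d := by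
      unfold LearnerState.observed
      split_ifs with h
      · simp [h.2]
      · simp
    rw [this]
    push_cast
    ring

theorem run_rewardSum_of_total_eq_zero {k : ℕ} {e : E} {j : Fin (Δ + 1)}
    (h : (run plan h₁ r ε k).total e j = 0) : (run plan h₁ r ε k).rewardSum e j = 0 := by
  rw [run_rewardSum, h]
  rw [run_total, Finset.sum_eq_zero_iff] at h
  simp only [Nat.cast_zero, zero_mul, zero_add]
  refine Finset.sum_eq_zero fun i hi => ?_
  rw [Finset.card_eq_zero.1 (h i hi), Finset.sum_empty]

theorem sum_run_total {L : ℕ} (hL : ∀ p : STPath G a b, p.edges.length = L) (k : ℕ) :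
    ∑ e, ∑ j, ((run plan h₁ r ε k).total e j : ℝ) = k * L := by
  induction k with
  | zero => simp [run, LearnerState.first, LearnerState.total]
  | succ k ih =>
    have h := (run plan h₁ r ε k).sum_path_eq fun _ _ => 1
    simp only [mul_one, Finset.sum_const, nsmul_eq_mul, STPath.card_edgeSet, hL] at h
    simp only [run_succ, LearnerState.next_total, Nat.cast_add, Finset.sum_add_distrib, ih, ← h]
    push_cast
    ring

/-- Round `k` belongs to an episode which starts in round `k₀`. -/
structure InEpisode (k₀ k : ℕ) : Prop where
  le : k₀ ≤ k
  cur_start : ∀ e j, (run plan h₁ r ε k₀).cur e j = 0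
  policy_start : (run plan h₁ r ε k₀).policy = plan (k₀ + 1) (run plan h₁ r ε k₀).total
    (run plan h₁ r ε k₀).empirical (run plan h₁ r ε k₀).hist
  policy : ∀ n, k₀ + n ≤ k → (run plan h₁ r ε (k₀ + n)).policy = (run plan h₁ r ε k₀).policy
  prior : ∀ n, k₀ + n ≤ k → (run plan h₁ r ε (k₀ + n)).prior = (run plan h₁ r ε k₀).prior
  hist : ∀ n, k₀ + n ≤ k → (run plan h₁ r ε (k₀ + n)).hist =
    (policyStep (run plan h₁ r ε k₀).policy)^[n] (run plan h₁ r ε k₀).hist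
  cur_lt : ∀ e j, (run plan h₁ r ε k).cur e j < max 1 ((run plan h₁ r ε k).prior e j)

variable {plan h₁ r ε}

theorem inEpisode_self {k : ℕ} (hcur : ∀ e j, (run plan h₁ r ε k).cur e j = 0)
    (hpol : (run plan h₁ r ε k).policy = plan (k + 1) (run plan h₁ r ε k).total
      (run plan h₁ r ε k).empirical (run plan h₁ r ε k).hist) :
    InEpisode plan h₁ r ε k k := by
  refine ⟨le_rfl, hcur, hpol, ?_, ?_, ?_, fun e j => by rw [hcur]; simp⟩ <;>
  · intro n hn
    obtain rfl : n = 0 := by omega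
    rfl

variable (plan h₁ r ε) in
theorem inEpisode_zero : InEpisode plan h₁ r ε 0 0 := by
  refine inEpisode_self (fun _ _ => rfl) ?_
  have hemp : (run plan h₁ r ε 0).empirical = fun _ _ => 0 := by
    funext e j
    simp [LearnerState.empirical, run, LearnerState.first]
  rw [hemp]
  rfl

/-- The number of doublings up to `n`, counting the first observation. -/
def doublings (n : ℕ) : ℕ := Nat.log 2 (2 * n)

theorem doublings_mono {m n : ℕ} (h : m ≤ n) : doublings m ≤ doublings n :=
  Nat.log_mono_right (by omega)

/-- With `2 * n` inside the logarithm, the passage from `0` to `1` observation also counts as a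
doubling, matching the threshold `max 1 m`. -/
theorem doublings_add_one_le {m n : ℕ} (h : m + max 1 m ≤ n) :
    doublings m + 1 ≤ doublings n := by
  unfold doublings
  rcases Nat.eq_zero_or_pos m with rfl | hm
  · have : 1 ≤ n := by simpa using h
    have := Nat.log_pos (b := 2) (by norm_num) (show 2 ≤ 2 * n by omega)
    rw [Nat.mul_zero, Nat.log_zero_right]
    omega
  · rw [← Nat.log_mul_base (by norm_num) (by omega)]
    apply Nat.log_mono_right
    have := le_max_right 1 m
    omega

/-- The number of doublings over all pairs. -/
def potential (N : CTable E Δ) : ℕ := ∑ e, ∑ j, doublings (N e j)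

theorem potential_add_one_le {M N : CTable E Δ} (h : ∀ e j, M e j ≤ N e j) {e : E}
    {j : Fin (Δ + 1)} (hej : M e j + max 1 (M e j) ≤ N e j) :
    potential M + 1 ≤ potential N := by
  refine Nat.succ_le_of_lt (Finset.sum_lt_sum
    (fun e _ => Finset.sum_le_sum fun j _ => doublings_mono (h e j)) ⟨e, Finset.mem_univ _, ?_⟩)
  exact Finset.sum_lt_sum (fun j _ => doublings_mono (h e j))
    ⟨j, Finset.mem_univ _, doublings_add_one_le hej⟩

/-- An episode ends only when some pair has reached its threshold, which raises `potential`; so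
`potential` bounds the number of finished episodes. -/
theorem InEpisode.succ {k₀ k : ℕ} (h : InEpisode plan h₁ r ε k₀ k) :
    InEpisode plan h₁ r ε k₀ (k + 1) ∨ (InEpisode plan h₁ r ε (k + 1) (k + 1) ∧
      potential (run plan h₁ r ε k₀).prior + 1 ≤ potential (run plan h₁ r ε (k + 1)).prior) := by
  obtain ⟨m, rfl⟩ := Nat.exists_eq_add_of_le h.le
  set S := run plan h₁ r ε (k₀ + m) with hS
  set y : E → ℝ := fun e => r e (useCount S.hist e) + ε (k₀ + m) e with hy
  have hrun : run plan h₁ r ε (k₀ + m + 1) = S.next plan y := run_succ _ _ _ _ _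
  by_cases hc : ∀ e j, (S.record y).cur e j < max 1 ((S.record y).prior e j)
  · left
    have hrun' : run plan h₁ r ε (k₀ + m + 1) = S.record y := by
      rw [hrun, LearnerState.next, if_pos hc]
    have hpol : S.policy = (run plan h₁ r ε k₀).policy := h.policy m le_rfl
    have hhist := h.hist m le_rfl
    rw [← hS] at hhist
    refine ⟨by omega, h.cur_start, h.policy_start, ?_, ?_, ?_, ?_⟩
    · intro n hn
      rcases Nat.lt_or_ge m n with hmn | hmn
      · obtain rfl : n = m + 1 := by omega
        rw [← Nat.add_assoc, hrun']
        exact hpol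
      · exact h.policy n (by omega)
    · intro n hn
      rcases Nat.lt_or_ge m n with hmn | hmn
      · obtain rfl : n = m + 1 := by omega
        rw [← Nat.add_assoc, hrun']
        exact h.prior m le_rfl
      · exact h.prior n (by omega)
    · intro n hn
      rcases Nat.lt_or_ge m n with hmn | hmn
      · obtain rfl : n = m + 1 := by omega
        rw [← Nat.add_assoc, hrun', Function.iterate_succ_apply', ← hhist, ← hpol]
        rfl
      · exact h.hist n (by omega)
    · rw [hrun']
      exact hc
  · right
    have hrun' : run plan h₁ r ε (k₀ + m + 1) = (S.record y).newEpisode plan := by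
      rw [hrun, LearnerState.next, if_neg hc]
    have hprior : S.prior = (run plan h₁ r ε k₀).prior := h.prior m le_rfl
    refine ⟨inEpisode_self ?_ ?_, ?_⟩
    · rw [hrun']
      intro e j
      rfl
    · have hround := run_round plan h₁ r ε (k₀ + m + 1)
      rw [hrun'] at hround ⊢
      change plan ((S.record y).newEpisode plan).round _ _ _ = _
      rw [hround]
      rfl
    · rw [hrun']
      push Not at hc
      obtain ⟨e, j, hej⟩ := hc
      refine potential_add_one_le (e := e) (j := j) (fun e' j' => ?_) ?_
      · rw [← hprior]
        exact Nat.le_add_right _ _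
      · rw [← hprior]
        exact Nat.add_le_add_left hej _

end Learner

/-! ### Regret on the event that the true rewards are feasible -/

section Regret

variable {V : Type*} {E : Type*} [Fintype E] [DecidableEq E]
variable {G : RGraph V E} {a b : V} {Δ : ℕ}

theorem width_mono {κ δ : ℝ} (hκ : 0 ≤ κ) (hδ : 0 < δ) {L : ℕ} (hL : 0 < L) (hΔ : 0 < Δ)
    [Nonempty E] {t T : ℕ} (ht : 0 < t) (htT : t ≤ T) (n : ℕ) :
    width E κ δ L Δ t n ≤ width E κ δ L Δ T n := by
  have hE : 0 < Fintype.card E := Fintype.card_pos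
  unfold width
  have : (t : ℝ) ≤ T := by exact_mod_cast htT
  gcongr

/-- The loss of an optimistic policy within an episode. -/
theorem episode_regret_le {r : RTable E Δ} {κ δ : ℝ} {L t₀ : ℕ} {N : CTable E Δ}
    {rhat : RTable E Δ} {π : Policy G a b Δ} {h : History G a b Δ}
    (hL : ∀ p : STPath G a b, p.edges.length = L)
    (hr : r ∈ feasible κ δ L t₀ N rhat) (hπ : IsOptimistic (feasible κ δ L t₀ N rhat) h π)
    {ρ : ℝ} (hρ : ∀ ρ', (∀ (π' : Policy G a b Δ) (ρ'' : ℝ), HasAvgReward r π' h ρ'' →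
      ρ'' ≤ ρ') → ρ ≤ ρ') (n : ℕ) :
    ∑ i ∈ Finset.range n, (ρ - pathReward r ((policyStep π)^[i] h) (π ((policyStep π)^[i] h))) ≤
      2 * Δ * L + ∑ i ∈ Finset.range n, ∑ e ∈ (π ((policyStep π)^[i] h)).edgeSet,
        2 * width E κ δ L Δ t₀ (N e (useCount ((policyStep π)^[i] h) e)) := by
  obtain ⟨⟨r', hr', ρ', havg, hmax⟩, hper⟩ := hπ
  -- The policy almost attains its gain `ρ'` for the optimistic table `r'`. Since `r` is feasible
  -- too, `ρ'` bounds all gains for `r` and hence exceeds `ρ`; it remains to exchange `r'` for `r`.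
  have h1 := mul_sub_policyReward_le (fun e j => (hr' e j).1.1) (hmax r' hr') havg hper n
  have h2 : ρ ≤ ρ' := hρ ρ' (hmax r hr)
  have h3 : ρ' ≤ L := by
    refine le_of_tendsto havg ?_
    filter_upwards [eventually_gt_atTop 0] with m hm
    rw [div_le_iff₀ (by positivity), mul_comm]
    exact policyReward_le (fun e j => (hr' e j).1.2) hL π h m
  have h4 : policyReward r' π h n - policyReward r π h n ≤
      ∑ i ∈ Finset.range n, ∑ e ∈ (π ((policyStep π)^[i] h)).edgeSet,
        2 * width E κ δ L Δ t₀ (N e (useCount ((policyStep π)^[i] h) e)) := by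
    unfold policyReward pathReward
    rw [← Finset.sum_sub_distrib]
    refine Finset.sum_le_sum fun i _ => ?_
    rw [← Finset.sum_sub_distrib]
    refine Finset.sum_le_sum fun e _ => ?_
    set j := useCount ((policyStep π)^[i] h) e
    have h5 := (abs_le.1 (hr' e j).2).2
    have h6 := (abs_le.1 (hr e j).2).1
    unfold width
    linarith
  have h7 : (n : ℝ) * ρ ≤ n * ρ' := mul_le_mul_of_nonneg_left h2 (Nat.cast_nonneg _)
  have h8 : 2 * (Δ : ℝ) * ρ' ≤ 2 * Δ * L := mul_le_mul_of_nonneg_left h3 (by positivity)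
  rw [Finset.sum_sub_distrib]
  simp only [Finset.sum_const, Finset.card_range, nsmul_eq_mul]
  change (n : ℝ) * ρ - policyReward r π h n ≤ _
  linarith

variable {plan : Planner G a b Δ} {h₁ : History G a b Δ} {r : RTable E Δ} {ε : ℕ → E → ℝ}

/-- The loss of the learner against the gain `ρ`, in terms of the confidence widths. -/
theorem run_regret_le {κ δ ρ : ℝ} {L T : ℕ} (hκ : 0 ≤ κ) (hδ : 0 < δ) (hL0 : 0 < L)
    (hΔ : 0 < Δ) [Nonempty E] (hL : ∀ p : STPath G a b, p.edges.length = L)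
    (hplan : IsOptimisticPlanner κ δ L plan)
    (hconf : ∀ k < T, r ∈ feasible κ δ L (k + 1) (run plan h₁ r ε k).total
      (run plan h₁ r ε k).empirical)
    (hρ : ∀ (h : History G a b Δ) (ρ' : ℝ), (∀ (π' : Policy G a b Δ) (ρ'' : ℝ),
      HasAvgReward r π' h ρ'' → ρ'' ≤ ρ') → ρ ≤ ρ') :
    ∑ i ∈ Finset.range T, (ρ - pathReward r (run plan h₁ r ε i).hist (run plan h₁ r ε i).path) ≤
      2 * Δ * L * (potential (run plan h₁ r ε T).prior + 1) +
      ∑ i ∈ Finset.range T, ∑ e ∈ (run plan h₁ r ε i).path.edgeSet, 2 * width E κ δ L Δ T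
        ((run plan h₁ r ε i).prior e (useCount (run plan h₁ r ε i).hist e)) := by
  set D : ℕ → ℝ := fun i =>
    ρ - pathReward r (run plan h₁ r ε i).hist (run plan h₁ r ε i).path with hD
  set W : ℕ → ℝ := fun i => ∑ e ∈ (run plan h₁ r ε i).path.edgeSet, 2 * width E κ δ L Δ T
    ((run plan h₁ r ε i).prior e (useCount (run plan h₁ r ε i).hist e)) with hW
  have hseg : ∀ k₀ n, InEpisode plan h₁ r ε k₀ (k₀ + n) → k₀ + n + 1 ≤ T →
      ∑ i ∈ Finset.range (n + 1), D (k₀ + i) ≤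
        2 * Δ * L + ∑ i ∈ Finset.range (n + 1), W (k₀ + i) := by
    intro k₀ n hep hle
    have hfe := hconf k₀ (by omega)
    have hopt := hplan.optimistic (k₀ + 1) _ _ (run plan h₁ r ε k₀).hist ⟨r, hfe⟩
    rw [← hep.policy_start] at hopt
    have hreg := episode_regret_le hL hfe hopt (hρ _) (n + 1)
    have e1 : ∀ i ∈ Finset.range (n + 1), D (k₀ + i) = ρ - pathReward r
        ((policyStep (run plan h₁ r ε k₀).policy)^[i] (run plan h₁ r ε k₀).hist)
        ((run plan h₁ r ε k₀).policy
          ((policyStep (run plan h₁ r ε k₀).policy)^[i] (run plan h₁ r ε k₀).hist)) := by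
      intro i hi
      have hin : k₀ + i ≤ k₀ + n := by have := Finset.mem_range.1 hi; omega
      simp only [hD, LearnerState.path, hep.policy i hin, hep.hist i hin]
    rw [Finset.sum_congr rfl e1]
    refine hreg.trans ?_
    gcongr with i hi
    have hin : k₀ + i ≤ k₀ + n := by have := Finset.mem_range.1 hi; omega
    simp only [hW, LearnerState.path, hep.policy i hin, hep.hist i hin, hep.prior i hin]
    refine Finset.sum_le_sum fun e _ => ?_
    have htot : (run plan h₁ r ε k₀).total = (run plan h₁ r ε k₀).prior := by
      funext e j
      simp [LearnerState.total, hep.cur_start]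
    rw [htot]
    exact mul_le_mul_of_nonneg_left
      (width_mono hκ hδ hL0 hΔ (by omega) (by omega) _) (by norm_num)
  have hseg' : ∀ k₀ k, InEpisode plan h₁ r ε k₀ k → k + 1 ≤ T →
      ∑ i ∈ Finset.range (k + 1), D i - ∑ i ∈ Finset.range k₀, D i ≤
        2 * Δ * L + (∑ i ∈ Finset.range (k + 1), W i - ∑ i ∈ Finset.range k₀, W i) := by
    intro k₀ k hep hle
    obtain ⟨n, rfl⟩ := Nat.exists_eq_add_of_le hep.le
    have := hseg k₀ n hep hle
    rw [Nat.add_assoc, Finset.sum_range_add D, Finset.sum_range_add W]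
    linarith
  -- Every finished episode pays its `2ΔL` with one unit of potential; the unfinished one is settled
  -- at the end by the `+ 1`.
  have hinv : ∀ k, k ≤ T → ∃ k₀, InEpisode plan h₁ r ε k₀ k ∧
      ∑ i ∈ Finset.range k₀, D i ≤ 2 * Δ * L * potential (run plan h₁ r ε k₀).prior +
        ∑ i ∈ Finset.range k₀, W i := by
    intro k
    induction k with
    | zero => exact fun _ => ⟨0, inEpisode_zero _ _ _ _, by simp; positivity⟩
    | succ k ih =>
      intro hk
      obtain ⟨k₀, hep, hb⟩ := ih (by omega)
      rcases hep.succ with h | ⟨h, hpot⟩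
      · exact ⟨k₀, h, hb⟩
      · refine ⟨k + 1, h, ?_⟩
        have h1 := hseg' k₀ k hep hk
        have h2 : ((potential (run plan h₁ r ε k₀).prior : ℕ) : ℝ) + 1 ≤
            (potential (run plan h₁ r ε (k + 1)).prior : ℕ) := by exact_mod_cast hpot
        have h3 := mul_le_mul_of_nonneg_left h2 (show 0 ≤ 2 * (Δ : ℝ) * L by positivity)
        linarith
  obtain ⟨k₀, hep, hb⟩ := hinv T le_rfl
  obtain ⟨n, hn⟩ := Nat.exists_eq_add_of_le hep.le
  have hprior : (run plan h₁ r ε T).prior = (run plan h₁ r ε k₀).prior := by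
    have := hep.prior n hn.symm.le
    rwa [← hn] at this
  rw [hprior]
  rcases Nat.eq_zero_or_pos n with rfl | hnpos
  · rw [Nat.add_zero] at hn
    rw [← hn] at hb ⊢
    have : 0 ≤ 2 * (Δ : ℝ) * L := by positivity
    linarith
  -- The last round played has index `T - 1`. It lies in the same episode because counts only grow,
  -- so the bound on `cur` at `T` passes back to it.
  · have hep' : InEpisode plan h₁ r ε k₀ (T - 1) := by
      refine ⟨by omega, hep.cur_start, hep.policy_start, fun m hm => hep.policy m (by omega),
        fun m hm => hep.prior m (by omega), fun m hm => hep.hist m (by omega), fun e j => ?_⟩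
      have h1 := hep.prior (n - 1) (by omega)
      have h2 := hep.cur_lt e j
      rw [show k₀ + (n - 1) = T - 1 by omega] at h1
      rw [h1]
      rw [hprior] at h2
      refine lt_of_le_of_lt ?_ h2
      have h3 := LearnerState.next_total plan (run plan h₁ r ε (T - 1))
        (fun e => r e (useCount (run plan h₁ r ε (T - 1)).hist e) + ε (T - 1) e) e j
      rw [← run_succ, show T - 1 + 1 = T by omega] at h3
      simp only [LearnerState.total, h1, hprior] at h3
      omega
    have h1 := hseg' k₀ (T - 1) hep' (by omega)
    rw [show T - 1 + 1 = T by omega] at h1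
    linarith

/-- Write `1 = (√(t+1) - √t)(√(t+1) + √t)` and bound both roots in the second factor by `√(2m)`. -/
theorem one_div_sqrt_le {t m : ℕ} (hm : 0 < m) (h : t + 1 ≤ 2 * m) :
    1 / √(m : ℝ) ≤ 2 * √2 * (√((t + 1 : ℕ) : ℝ) - √(t : ℝ)) := by
  have hm' : (0 : ℝ) < m := by exact_mod_cast hm
  have ht : (0 : ℝ) < ((t + 1 : ℕ) : ℝ) := by positivity
  have h1 : √((t + 1 : ℕ) : ℝ) ≤ √2 * √(m : ℝ) := by
    rw [← Real.sqrt_mul (by norm_num)]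
    exact Real.sqrt_le_sqrt (by exact_mod_cast h)
  have h2 : √(t : ℝ) ≤ √((t + 1 : ℕ) : ℝ) := Real.sqrt_le_sqrt (by push_cast; linarith)
  have h3 : (√((t + 1 : ℕ) : ℝ) - √(t : ℝ)) * (√((t + 1 : ℕ) : ℝ) + √(t : ℝ)) = 1 := by
    have e1 := Real.mul_self_sqrt ht.le
    have e2 := Real.mul_self_sqrt (Nat.cast_nonneg (α := ℝ) t)
    push_cast at *
    linarith
  set x := √((t + 1 : ℕ) : ℝ)
  set y := √(t : ℝ)
  have hx : 0 < x := Real.sqrt_pos.2 ht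
  have hms : 0 < √(m : ℝ) := Real.sqrt_pos.2 hm'
  rw [div_le_iff₀ hms]
  have h4 : 0 ≤ x - y := by linarith
  calc (1 : ℝ) = (x - y) * (x + y) := h3.symm
    _ ≤ (x - y) * (2 * (√2 * √(m : ℝ))) := by
        apply mul_le_mul_of_nonneg_left _ h4
        linarith
    _ = _ := by ring

theorem exists_inEpisode (k : ℕ) : ∃ k₀, InEpisode plan h₁ r ε k₀ k := by
  induction k with
  | zero => exact ⟨0, inEpisode_zero _ _ _ _⟩
  | succ k ih =>
    obtain ⟨k₀, h⟩ := ih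
    rcases h.succ with h | ⟨h, -⟩
    exacts [⟨_, h⟩, ⟨_, h⟩]

/-- Within an episode `cur < max 1 prior`, so total plus one is at most `2 * max 1 prior`; each
width is then charged to an increment of `√total`. -/
theorem sum_inv_sqrt_prior_le (T : ℕ) :
    ∑ i ∈ Finset.range T, ∑ e ∈ (run plan h₁ r ε i).path.edgeSet,
      1 / √((max 1 ((run plan h₁ r ε i).prior e (useCount (run plan h₁ r ε i).hist e)) : ℕ) : ℝ) ≤
      2 * √2 * ∑ e, ∑ j, √((run plan h₁ r ε T).total e j : ℝ) := by
  induction T with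
  | zero => simp [run, LearnerState.first, LearnerState.total]
  | succ T ih =>
    set S := run plan h₁ r ε T with hS
    have hcur : ∀ e j, S.cur e j < max 1 (S.prior e j) :=
      (exists_inEpisode (plan := plan) (h₁ := h₁) (r := r) (ε := ε) T).choose_spec.cur_lt
    rw [Finset.sum_range_succ, ← hS,
      S.sum_path_eq fun e j => 1 / √((max 1 (S.prior e j) : ℕ) : ℝ)]
    have h : ∑ e, ∑ j, ((S.observed e j).card : ℝ) * (1 / √((max 1 (S.prior e j) : ℕ) : ℝ)) ≤
        ∑ e, ∑ j, 2 * √2 *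
          (√((run plan h₁ r ε (T + 1)).total e j : ℝ) - √(S.total e j : ℝ)) := by
      refine Finset.sum_le_sum fun e _ => Finset.sum_le_sum fun j _ => ?_
      rw [run_succ, LearnerState.next_total, ← hS]
      have hc := S.card_observed_le e j
      rcases Nat.le_one_iff_eq_zero_or_eq_one.1 hc with h0 | h0
      · simp [h0]
      · rw [h0, Nat.cast_one, one_mul]
        refine one_div_sqrt_le (by simp) ?_
        have h1 := hcur e j
        have h2 := le_max_right 1 (S.prior e j)
        simp only [LearnerState.total]
        omega
    simp only [← Finset.mul_sum, Finset.sum_sub_distrib, mul_sub] at h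
    linarith

theorem sum_sqrt_le {L : ℕ} (hL : ∀ p : STPath G a b, p.edges.length = L) (T : ℕ) :
    ∑ e, ∑ j, √((run plan h₁ r ε T).total e j : ℝ) ≤
      √(Fintype.card E * (Δ + 1) * (T * L)) := by
  apply Real.le_sqrt_of_sq_le
  rw [← Fintype.sum_prod_type' fun e j => √((run plan h₁ r ε T).total e j : ℝ)]
  refine sq_sum_le_card_mul_sum_sq.trans (le_of_eq ?_)
  have h : ∑ x : E × Fin (Δ + 1), √((run plan h₁ r ε T).total x.1 x.2 : ℝ) ^ 2 = T * L := by
    rw [← sum_run_total plan h₁ r ε hL T,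
      ← Fintype.sum_prod_type' fun e j => ((run plan h₁ r ε T).total e j : ℝ)]
    exact Finset.sum_congr rfl fun x _ => Real.sq_sqrt (Nat.cast_nonneg _)
  rw [h]
  simp

theorem sum_width_le {κ δ : ℝ} (hκ : 0 ≤ κ) {L : ℕ}
    (hL : ∀ p : STPath G a b, p.edges.length = L) (hΔ : 0 < Δ) (T : ℕ) :
    ∑ i ∈ Finset.range T, ∑ e ∈ (run plan h₁ r ε i).path.edgeSet, 2 * width E κ δ L Δ T
        ((run plan h₁ r ε i).prior e (useCount (run plan h₁ r ε i).hist e)) ≤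
      8 * κ * √(L * Fintype.card E * Δ * T *
        Real.log ((L * Fintype.card E * Δ * T : ℝ) / δ)) := by
  set ℓ := Real.log ((L * Fintype.card E * Δ * T : ℝ) / δ) with hℓ
  have h1 : ∀ n : ℕ, 2 * width E κ δ L Δ T n =
      2 * κ * √ℓ * (1 / √((max 1 n : ℕ) : ℝ)) := by
    intro n
    rw [width, Real.sqrt_div' _ (Nat.cast_nonneg _), ← hℓ]
    ring
  simp only [h1, ← Finset.mul_sum]
  calc 2 * κ * √ℓ * _ ≤ 2 * κ * √ℓ * (2 * √2 * √(Fintype.card E * (Δ + 1) * (T * L))) := by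
        refine mul_le_mul_of_nonneg_left ?_ (by positivity)
        refine (sum_inv_sqrt_prior_le T).trans ?_
        exact mul_le_mul_of_nonneg_left (sum_sqrt_le hL T) (by positivity)
    _ ≤ 2 * κ * √ℓ * (2 * √2 * √(2 * (L * Fintype.card E * Δ * T))) := by
        have : (1 : ℝ) ≤ Δ := by exact_mod_cast hΔ
        have h2 : (Fintype.card E * (Δ + 1) * (T * L) : ℝ) ≤
            2 * (L * Fintype.card E * Δ * T) := by
          have h3 : (0 : ℝ) ≤ Fintype.card E * (T * L) := by positivity
          nlinarith
        gcongr
    _ = 8 * κ * (√(L * Fintype.card E * Δ * T) * √ℓ) := by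
        rw [Real.sqrt_mul (by norm_num) (L * Fintype.card E * Δ * T : ℝ)]
        have := Real.mul_self_sqrt (show (0 : ℝ) ≤ 2 by norm_num)
        linear_combination (4 * κ * √ℓ * √(L * Fintype.card E * Δ * T)) * this
    _ = _ := by rw [Real.sqrt_mul (show (0 : ℝ) ≤ L * Fintype.card E * Δ * T by positivity)]

theorem doublings_mul_log_le (n : ℕ) : (doublings n : ℝ) * Real.log 2 ≤ Real.log (1 + 2 * n) := by
  rw [← Real.log_pow]
  apply Real.log_le_log (by positivity)
  rcases Nat.eq_zero_or_pos n with rfl | hn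
  · simp [doublings]
  · have : 2 ^ doublings n ≤ 2 * n := Nat.pow_log_le_self 2 (by omega)
    have h2 : ((2 ^ doublings n : ℕ) : ℝ) ≤ ((2 * n : ℕ) : ℝ) := by exact_mod_cast this
    push_cast at h2
    linarith

/-- Summed over all pairs with one common `y`, the tangent line plays the part of Jensen's
inequality for the logarithm. -/
theorem log_le_tangent {x y : ℝ} (hx : 0 < x) (hy : 0 < y) :
    Real.log x ≤ Real.log y + (x - y) / y := by
  have h := Real.log_le_sub_one_of_pos (div_pos hx hy)
  rw [Real.log_div hx.ne' hy.ne'] at h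
  have : (x - y) / y = x / y - 1 := by field_simp
  linarith

theorem potential_le {L T : ℕ} (hL : ∀ p : STPath G a b, p.edges.length = L) (hΔ : 0 < Δ)
    [Nonempty E] (hx : 3 * ((Δ : ℝ) * Fintype.card E) ≤ L * T) :
    (potential (run plan h₁ r ε T).prior : ℝ) ≤
      6 * (Fintype.card E * Δ) * Real.log ((L * T : ℝ) / (Δ * Fintype.card E)) := by
  have hE : (0 : ℝ) < Fintype.card E := by exact_mod_cast Fintype.card_pos
  have hΔ1 : (1 : ℝ) ≤ Δ := by exact_mod_cast hΔ
  set x : ℝ := (L * T : ℝ) / (Δ * Fintype.card E) with hxdef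
  have hx3 : 3 ≤ x := by rw [hxdef, le_div_iff₀ (by positivity)]; exact hx
  have hlogx : 0 ≤ Real.log x := Real.log_nonneg (by linarith)
  -- Here `x` is the number of observations per pair if there were `E Δ` pairs. As there are `E (Δ +
  -- 1)`, the linear tangent terms sum to something nonpositive (`hneg`).
  set y : ℝ := 1 + 2 * x with hy
  have hy0 : 0 < y := by positivity
  have hsum := sum_run_total plan h₁ r ε hL T
  have hcard : ∑ _e : E, ∑ _j : Fin (Δ + 1), (1 : ℝ) = Fintype.card E * (Δ + 1) := by
    simp; ring
  have hpt : ∀ e j, (doublings ((run plan h₁ r ε T).prior e j) : ℝ) * Real.log 2 ≤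
      1 * (Real.log y + (1 - y) / y) + 2 / y * (run plan h₁ r ε T).total e j := by
    intro e j
    have h1 : (doublings ((run plan h₁ r ε T).prior e j) : ℝ) ≤
        doublings ((run plan h₁ r ε T).total e j) := by
      exact_mod_cast doublings_mono (Nat.le_add_right _ _)
    have h2 := doublings_mul_log_le ((run plan h₁ r ε T).total e j)
    have h3 := log_le_tangent (x := 1 + 2 * ((run plan h₁ r ε T).total e j : ℝ))
      (by positivity) hy0
    have h4 := mul_le_mul_of_nonneg_right h1 (Real.log_pos one_lt_two).le
    have h5 : (1 + 2 * ((run plan h₁ r ε T).total e j : ℝ) - y) / y =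
      (1 - y) / y + 2 / y * (run plan h₁ r ε T).total e j := by field_simp; ring
    linarith
  have hpot : (potential (run plan h₁ r ε T).prior : ℝ) * Real.log 2 ≤
      (Fintype.card E * (Δ + 1)) * (Real.log y + (1 - y) / y) + 2 / y * (T * L) := by
    unfold potential
    rw [← hsum, ← hcard]
    push_cast
    simp only [Finset.sum_mul, Finset.mul_sum, ← Finset.sum_add_distrib]
    exact Finset.sum_le_sum fun e _ => Finset.sum_le_sum fun j _ => hpt e j
  have hTL : (T * L : ℝ) = x * (Fintype.card E * Δ) := by
    rw [hxdef]; field_simp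
  have hneg : (Fintype.card E * (Δ + 1) : ℝ) * ((1 - y) / y) + 2 / y * (T * L) ≤ 0 := by
    rw [hTL]
    have : (Fintype.card E * (Δ + 1) : ℝ) * ((1 - y) / y) + 2 / y * (x * (Fintype.card E * Δ)) =
      -(2 * x * Fintype.card E / y) := by
      rw [hy]; field_simp; ring
    rw [this]
    have : 0 ≤ 2 * x * Fintype.card E / y := by positivity
    linarith
  -- For `x ≥ 3` one has `1 + 2x ≤ x ^ 2`. With `Δ + 1 ≤ 2Δ` this gives the factor `4 / log 2`,
  -- which is below `6`.
  have hlogy : Real.log y ≤ 2 * Real.log x := by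
    rw [← Nat.cast_two (R := ℝ), ← Real.log_pow]
    apply Real.log_le_log hy0
    nlinarith
  have h1 : (Fintype.card E * (Δ + 1) : ℝ) * Real.log y ≤
      (Fintype.card E * (2 * Δ)) * (2 * Real.log x) := by
    have hlogy0 : 0 ≤ Real.log y := Real.log_nonneg (by linarith)
    gcongr
    linarith
  have h2 := Real.log_two_gt_d9
  have h3 : (0 : ℝ) ≤ (potential (run plan h₁ r ε T).prior : ℝ) := Nat.cast_nonneg _
  have h4 : 0 ≤ (Fintype.card E * Δ : ℝ) * Real.log x := by positivity
  nlinarith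

theorem policyRegret_eq (T : ℕ) : policyRegret plan h₁ r ε T =
    (⨆ π : Policy G a b Δ, policyReward r π h₁ T) -
      ∑ i ∈ Finset.range T, pathReward r (run plan h₁ r ε i).hist (run plan h₁ r ε i).path -
      ∑ i ∈ Finset.range T, ∑ e ∈ (run plan h₁ r ε i).path.edgeSet, ε i e := by
  unfold policyRegret pathReward
  simp only [Finset.sum_add_distrib]
  ring

theorem mean_regret_le {κ δ : ℝ} {L T : ℕ} [Nonempty (STPath G a b)] (hκ : 0 ≤ κ) (hδ : 0 < δ)
    (hδ1 : δ < 1) (hL0 : 0 < L) (hΔ : 0 < Δ) (hT : 0 < T) (hE : 2 ≤ Fintype.card E)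
    (hL : ∀ p : STPath G a b, p.edges.length = L)
    (hplan : IsOptimisticPlanner κ δ L plan)
    (hr0 : ∀ e j, 0 ≤ r e j) (hr1 : ∀ e j, r e j ≤ 1)
    (hconf : ∀ k < T, r ∈ feasible κ δ L (k + 1) (run plan h₁ r ε k).total
      (run plan h₁ r ε k).empirical) :
    (⨆ π : Policy G a b Δ, policyReward r π h₁ T) -
      ∑ i ∈ Finset.range T, pathReward r (run plan h₁ r ε i).hist (run plan h₁ r ε i).path ≤
    15 * (L * (Δ : ℝ) ^ 2 * Fintype.card E *
      Real.posLog ((L * T : ℝ) / (Δ * Fintype.card E))) +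
    (8 * κ + 3) * √(L * Fintype.card E * Δ * T *
      Real.log ((L * Fintype.card E * Δ * T : ℝ) / δ)) := by
  have : Nonempty E := Fintype.card_pos_iff.1 (by omega)
  have hE' : (2 : ℝ) ≤ Fintype.card E := by exact_mod_cast hE
  have hL' : (1 : ℝ) ≤ L := by exact_mod_cast hL0
  have hΔ' : (1 : ℝ) ≤ Δ := by exact_mod_cast hΔ
  have hT' : (1 : ℝ) ≤ T := by exact_mod_cast hT
  set M := ⨆ π : Policy G a b Δ, policyReward r π h₁ T with hM
  have hMle : M ≤ T * L := ciSup_le fun π => policyReward_le hr1 hL π h₁ T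
  have hpos : 0 ≤ Real.posLog ((L * T : ℝ) / (Δ * Fintype.card E)) := Real.posLog_nonneg
  set X := √(L * Fintype.card E * Δ * T *
      Real.log ((L * Fintype.card E * Δ * T : ℝ) / δ)) with hX
  have hX0 : 0 ≤ X := Real.sqrt_nonneg _
  rcases le_total (3 * ((Δ : ℝ) * Fintype.card E)) (L * T) with hx | hx
  -- By `playReward_le_of_avg`, `M` is at most `T + Δ` times any bound on the gains from any
  -- history, so this `ρ` is a valid benchmark at the start of every episode. It falls short of `M`
  -- over `T` rounds by `Δρ ≤ ΔL` only.
  · set ρ := M / (T + Δ) with hρ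
    have hTΔ : (0 : ℝ) < T + Δ := by linarith
    have hρle : ∀ (h : History G a b Δ) (ρ' : ℝ), (∀ (π' : Policy G a b Δ) (ρ'' : ℝ),
        HasAvgReward r π' h ρ'' → ρ'' ≤ ρ') → ρ ≤ ρ' := by
      intro h ρ' hρ'
      rw [hρ, div_le_iff₀ hTΔ]
      refine ciSup_le fun π => ?_
      have := playReward_le_of_avg hr0 h ρ' hρ' (policyPaths π h₁ T) h₁
      rw [playReward_policyPaths, length_policyPaths] at this
      linarith
    have hρL : ρ ≤ L := by
      rw [hρ, div_le_iff₀ hTΔ]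
      nlinarith
    have h1 := run_regret_le hκ hδ hL0 hΔ hL hplan hconf hρle
    have h2 := sum_width_le (plan := plan) (h₁ := h₁) (r := r) (ε := ε) (δ := δ) hκ hL hΔ T
    have h3 := potential_le (plan := plan) (h₁ := h₁) (r := r) (ε := ε) hL hΔ hx
    rw [← hX] at h2
    rw [Finset.sum_sub_distrib] at h1
    simp only [Finset.sum_const, Finset.card_range, nsmul_eq_mul] at h1
    have hMρ : M = T * ρ + Δ * ρ := by rw [hρ]; field_simp
    have hx3 : 3 ≤ (L * T : ℝ) / (Δ * Fintype.card E) := by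
      rw [le_div_iff₀ (by positivity)]; exact hx
    have hlog : Real.log ((L * T : ℝ) / (Δ * Fintype.card E)) =
        Real.posLog ((L * T : ℝ) / (Δ * Fintype.card E)) := by
      rw [Real.posLog_eq_log]
      rw [abs_of_nonneg (by linarith)]
      linarith
    -- The argument is at least `3 > e`, so the additive `3ΔL` is absorbed into the logarithmic
    -- term, whence `15 = 12 + 3`.
    have hlog1 : 1 ≤ Real.posLog ((L * T : ℝ) / (Δ * Fintype.card E)) := by
      rw [← hlog, Real.le_log_iff_exp_le (by linarith)]
      have := Real.exp_one_lt_d9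
      linarith
    rw [hlog] at h3
    set p := Real.posLog ((L * T : ℝ) / (Δ * Fintype.card E))
    have h4 : (Δ : ℝ) * ρ ≤ Δ * L := mul_le_mul_of_nonneg_left hρL (by linarith)
    have h5 : 2 * (Δ : ℝ) * L * (potential (run plan h₁ r ε T).prior + 1) ≤
        2 * Δ * L * (6 * (Fintype.card E * Δ) * p + 1) := by gcongr
    have h6 : 3 * ((Δ : ℝ) * L) ≤ 3 * (Δ * L * (Fintype.card E * Δ * p)) := by
      have : 1 ≤ Fintype.card E * Δ * p := by
        have h7 : (1 : ℝ) ≤ Fintype.card E * Δ := by nlinarith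
        nlinarith
      have h8 : 0 ≤ (Δ : ℝ) * L := by positivity
      nlinarith
    nlinarith
  -- For short horizons `LT ≤ 3ΔE`, the trivial bound `TL` on the regret is already at most `3X`, as
  -- the logarithm in `X` is at least `log 2 > 1/3`.
  · have h1 : 0 ≤ ∑ i ∈ Finset.range T,
        pathReward r (run plan h₁ r ε i).hist (run plan h₁ r ε i).path :=
      Finset.sum_nonneg fun _ _ => pathReward_nonneg hr0 _ _
    have h2 : (T * L : ℝ) ≤ 3 * X := by
      have hq : (2 : ℝ) ≤ L * Fintype.card E * Δ * T := by
        calc (2 : ℝ) = 1 * 2 * 1 * 1 := by norm_num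
          _ ≤ L * Fintype.card E * Δ * T := by gcongr
      have hlog2 : Real.log 2 ≤ Real.log ((L * Fintype.card E * Δ * T : ℝ) / δ) := by
        apply Real.log_le_log (by norm_num)
        rw [le_div_iff₀ hδ]
        nlinarith
      have hd9 := Real.log_two_gt_d9
      have h3 : (T * L : ℝ) ^ 2 ≤ 9 * (L * Fintype.card E * Δ * T *
          Real.log ((L * Fintype.card E * Δ * T : ℝ) / δ)) := by
        have e1 : (T * L : ℝ) ^ 2 ≤ (T * L) * (3 * (Δ * Fintype.card E)) := by
          rw [sq]
          apply mul_le_mul_of_nonneg_left _ (by positivity)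
          linarith
        have e2 : (L * Fintype.card E * Δ * T : ℝ) * (1 / 3) ≤ L * Fintype.card E * Δ * T *
          Real.log ((L * Fintype.card E * Δ * T : ℝ) / δ) := by
          apply mul_le_mul_of_nonneg_left _ (by positivity)
          linarith
        nlinarith
      have h4 : (T * L : ℝ) ≤ √(9 * (L * Fintype.card E * Δ * T *
          Real.log ((L * Fintype.card E * Δ * T : ℝ) / δ))) := Real.le_sqrt_of_sq_le h3
      rw [Real.sqrt_mul (by norm_num), show (9 : ℝ) = 3 ^ 2 by norm_num,
        Real.sqrt_sq (by norm_num)] at h4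
      exact h4
    have h3 : 0 ≤ 15 * (L * (Δ : ℝ) ^ 2 * Fintype.card E *
      Real.posLog ((L * T : ℝ) / (Δ * Fintype.card E))) := by positivity
    have h4 : 0 ≤ 8 * κ * X := by positivity
    linarith

end Regret

/-! ### Probability of the good event -/

section HighProbability

variable {V : Type*} {E : Type*} [Fintype E] [DecidableEq E]
variable {G : RGraph V E} {a b : V} {Δ : ℕ}
variable {plan : Planner G a b Δ} {h₁ : History G a b Δ} {r : RTable E Δ}
variable {Ω : Type*} [MeasurableSpace Ω] {P : Measure Ω} [IsProbabilityMeasure P]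
variable {ε : ℕ → E → Ω → ℝ}

theorem ofReal_one_sub_le_measure {δ : ℝ} (hδ : 0 ≤ δ) {s : Set Ω}
    (hs : P sᶜ ≤ ENNReal.ofReal δ) : ENNReal.ofReal (1 - δ) ≤ P s := by
  rw [ENNReal.ofReal_sub _ hδ, ENNReal.ofReal_one, tsub_le_iff_right]
  calc (1 : ENNReal) = P (s ∪ sᶜ) := by rw [Set.union_compl_self, measure_univ]
    _ ≤ P s + P sᶜ := measure_union_le _ _
    _ ≤ P s + ENNReal.ofReal δ := by gcongr

/-- The total noise of the learner is rarely very negative. -/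
theorem measure_total_noise_le (hm : ∀ k e, Measurable (ε k e))
    (hg : ∀ k e, P.map (ε k e) = gaussianReal 0 1)
    (hi : iIndepFun (fun (k : ℕ) (ω : Ω) (e : E) => ε k e ω) P)
    (hplan : ∀ (t₀ : ℕ) (N : CTable E Δ) (h : History G a b Δ) (π : Policy G a b Δ),
      MeasurableSet {rhat : RTable E Δ | plan t₀ N rhat h = π})
    {L T : ℕ} (hL : ∀ p : STPath G a b, p.edges.length = L) (hL0 : 0 < L) (hT : 0 < T)
    {η : ℝ} (hη : 0 < η) (hη1 : η ≤ 1) :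
    P {ω | L * √(2 * T * Real.log (1 / η)) < -∑ i ∈ Finset.range T,
      ∑ e ∈ (run plan h₁ r (fun k e => ε k e ω) i).path.edgeSet, ε i e ω} ≤
      ENNReal.ofReal η := by
  set A : ℕ → Ω → Finset E := fun i ω => (run plan h₁ r (fun k e => ε k e ω) i).path.edgeSet
    with hA
  have hAm : ∀ k S, MeasurableSet[noisePast ε k] {ω | A k ω = S} := fun k S =>
    measurableSet_run_histPolicy hplan h₁ r ε k fun h π => (π h).edgeSet = S
  have hlog : 0 ≤ Real.log (1 / η) := Real.log_nonneg (by rw [le_div_iff₀ hη]; linarith)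
  set x : ℝ := L * √(2 * T * Real.log (1 / η)) with hx
  have hx0 : 0 ≤ x := by positivity
  have hv : (0 : ℝ) < T * L ^ 2 := by positivity
  have h := measure_noiseSum_ge_le hm hg hi hAm T (s := -1) (by norm_num) x hv
  have hexp : Real.exp (-(x ^ 2 / (2 * (T * L ^ 2)))) = η := by
    have : x ^ 2 / (2 * (T * L ^ 2)) = Real.log (1 / η) := by
      rw [hx, mul_pow, Real.sq_sqrt (by positivity)]
      field_simp
    rw [this, one_div, Real.log_inv, neg_neg, Real.exp_log hη]
  rw [hexp] at h
  refine (measure_mono ?_).trans h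
  intro ω hω
  refine ⟨?_, ?_⟩
  · rw [abs_of_nonneg hx0, neg_one_mul]
    exact le_of_lt hω
  · simp [noiseVar, hA, STPath.card_edgeSet, hL]

/-- The true rewards are feasible as soon as the noise in the empirical means is small. -/
theorem mem_feasible_of_noise_le {ε : ℕ → E → ℝ} {κ δ : ℝ} {L k : ℕ} (hκ : 10 ≤ κ) (hδ : 0 < δ)
    (hδ1 : δ < 1) (hQ : 2 ≤ L * Fintype.card E * Δ)
    (hr0 : ∀ e j, 0 ≤ r e j) (hr1 : ∀ e j, r e j ≤ 1)
    (hnoise : ∀ e j, 0 < (run plan h₁ r ε k).total e j →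
      |∑ i ∈ Finset.range k, ∑ d ∈ (run plan h₁ r ε i).observed e j, ε i d| ≤
      κ * √((run plan h₁ r ε k).total e j *
        Real.log ((L * Fintype.card E * Δ * (k + 1 : ℕ) : ℝ) / δ))) :
    r ∈ feasible κ δ L (k + 1) (run plan h₁ r ε k).total (run plan h₁ r ε k).empirical := by
  intro e j
  refine ⟨⟨hr0 e j, hr1 e j⟩, ?_⟩
  set ℓ := Real.log ((L * Fintype.card E * Δ * (k + 1 : ℕ) : ℝ) / δ) with hℓ
  unfold LearnerState.empirical
  rcases Nat.eq_zero_or_pos ((run plan h₁ r ε k).total e j) with h0 | hpos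
  -- An unobserved pair has empirical mean `0`; since `log 2 ≥ 1/4` and `κ ≥ 10`, its width exceeds
  -- `1` and excludes nothing.
  · rw [run_rewardSum_of_total_eq_zero plan h₁ r ε h0, h0]
    have hlog2 : Real.log 2 ≤ ℓ := by
      apply Real.log_le_log (by norm_num)
      rw [le_div_iff₀ hδ]
      have h1 : (2 : ℝ) ≤ L * Fintype.card E * Δ := by exact_mod_cast hQ
      have h2 : (1 : ℝ) ≤ (k + 1 : ℕ) := by push_cast; linarith [Nat.cast_nonneg (α := ℝ) k]
      nlinarith
    have hd9 := Real.log_two_gt_d9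
    have h1 : 1 / 2 ≤ √ℓ := Real.le_sqrt_of_sq_le (by linarith)
    simp only [sub_zero, max_eq_left (Nat.zero_le 1), Nat.cast_one, div_one]
    rw [abs_of_nonneg (hr0 e j)]
    nlinarith [hr1 e j]
  · have hn := hnoise e j hpos
    rw [run_rewardSum, max_eq_right (by omega : 1 ≤ (run plan h₁ r ε k).total e j)]
    set n := (run plan h₁ r ε k).total e j
    set X := ∑ i ∈ Finset.range k, ∑ d ∈ (run plan h₁ r ε i).observed e j, ε i d
    have hn0 : (0 : ℝ) < n := by exact_mod_cast hpos
    have h1 : r e j - (n * r e j + X) / n = -(X / n) := by field_simp; ring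
    have h2 : √(ℓ / n) = √(n * ℓ) / n := by
      rw [show ℓ / (n : ℝ) = n * ℓ / n ^ 2 by field_simp, Real.sqrt_div' _ (by positivity),
        Real.sqrt_sq hn0.le]
    rw [h1, abs_neg, abs_div, abs_of_pos hn0, h2, ← mul_div_assoc]
    gcongr

theorem sum_inv_sq_le (T : ℕ) : ∑ k ∈ Finset.range T, (1 : ℝ) / (k + 1 : ℕ) ^ 2 ≤ 2 := by
  suffices h : ∑ k ∈ Finset.range T, (1 : ℝ) / (k + 1 : ℕ) ^ 2 ≤ 2 * (1 - 1 / (T + 1)) by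
    have : (0 : ℝ) ≤ 1 / (T + 1) := by positivity
    linarith
  induction T with
  | zero => norm_num
  | succ T ih =>
    rw [Finset.sum_range_succ]
    have h : (1 : ℝ) / (T + 1 : ℕ) ^ 2 ≤ 2 * (1 / (T + 1) - 1 / (T + 1 + 1)) := by
      have : (0 : ℝ) ≤ T := Nat.cast_nonneg T
      rw [div_sub_div _ _ (by positivity) (by positivity), ← mul_div_assoc,
        div_le_div_iff₀ (by positivity) (by positivity)]
      push_cast
      nlinarith
    push_cast at *
    linarith

/-- The number of observations is random, so the deviation is bounded at a deterministic level `n`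
on the event that the count is at most `n`; a union over `n` follows in `measure_not_feasible_le`.
-/
theorem measure_noise_gt_le (hm : ∀ k e, Measurable (ε k e))
    (hg : ∀ k e, P.map (ε k e) = gaussianReal 0 1)
    (hi : iIndepFun (fun (k : ℕ) (ω : Ω) (e : E) => ε k e ω) P)
    (hplan : ∀ (t₀ : ℕ) (N : CTable E Δ) (h : History G a b Δ) (π : Policy G a b Δ),
      MeasurableSet {rhat : RTable E Δ | plan t₀ N rhat h = π})
    (k n : ℕ) (e : E) (j : Fin (Δ + 1)) (hn : 0 < n) {s κ ℓ : ℝ} (hs : s ^ 2 = 1)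
    (hκ : 10 ≤ κ) (hℓ : 0 ≤ ℓ) :
    P {ω | κ * √(n * ℓ) ≤ s * ∑ i ∈ Finset.range k,
        ∑ d ∈ (run plan h₁ r (fun k e => ε k e ω) i).observed e j, ε i d ω ∧
        (run plan h₁ r (fun k e => ε k e ω) k).total e j ≤ n} ≤
      ENNReal.ofReal (Real.exp (-ℓ) ^ 7) := by
  set A : ℕ → Ω → Finset E := fun i ω => (run plan h₁ r (fun k e => ε k e ω) i).observed e j
    with hA
  have hAm : ∀ k S, MeasurableSet[noisePast ε k] {ω | A k ω = S} := fun k S =>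
    measurableSet_run_histPolicy hplan h₁ r ε k fun h π =>
      (if e ∈ (π h).edgeSet ∧ useCount h e = j then {e} else ∅) = S
  have hv : (0 : ℝ) < n := by exact_mod_cast hn
  have h := measure_noiseSum_ge_le hm hg hi hAm k hs (κ * √(n * ℓ)) hv
  refine (measure_mono ?_).trans (h.trans (ENNReal.ofReal_le_ofReal ?_))
  · rintro ω ⟨h1, h2⟩
    refine ⟨by rw [abs_of_nonneg (by positivity)]; exact h1, ?_⟩
    rw [run_total] at h2
    have h3 : noiseVar A k ω = ((∑ i ∈ Finset.range k, (A i ω).card : ℕ) : ℝ) := by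
      unfold noiseVar
      push_cast
      refine Finset.sum_congr rfl fun i _ => ?_
      rcases Nat.le_one_iff_eq_zero_or_eq_one.1
        (LearnerState.card_observed_le (run plan h₁ r (fun k e => ε k e ω) i) e j) with h0 | h0
      · simp [hA, h0]
      · simp [hA, h0]
    rw [h3]
    exact_mod_cast h2
  · rw [← Real.exp_nat_mul]
    apply Real.exp_le_exp.2
    have h4 : (κ * √(n * ℓ)) ^ 2 / (2 * n) = κ ^ 2 / 2 * ℓ := by
      rw [mul_pow, Real.sq_sqrt (by positivity)]
      field_simp
    rw [h4]
    push_cast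
    -- The exponent `κ ^ 2 / 2 ≥ 50` leaves ample room; power `7` suffices for the union bounds.
    nlinarith [mul_nonneg (show (0 : ℝ) ≤ κ ^ 2 / 2 - 7 by nlinarith) hℓ]

theorem measure_not_feasible_le (hm : ∀ k e, Measurable (ε k e))
    (hg : ∀ k e, P.map (ε k e) = gaussianReal 0 1)
    (hi : iIndepFun (fun (k : ℕ) (ω : Ω) (e : E) => ε k e ω) P)
    (hplan : ∀ (t₀ : ℕ) (N : CTable E Δ) (h : History G a b Δ) (π : Policy G a b Δ),
      MeasurableSet {rhat : RTable E Δ | plan t₀ N rhat h = π})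
    {κ δ : ℝ} {L : ℕ} (hκ : 10 ≤ κ) (hδ : 0 < δ)
    (hδ1 : δ < 1) (hL0 : 0 < L) (hΔ : 0 < Δ) (hQ : 2 ≤ L * Fintype.card E * Δ)
    (hr0 : ∀ e j, 0 ≤ r e j) (hr1 : ∀ e j, r e j ≤ 1) (k : ℕ) :
    P {ω | r ∉ feasible κ δ L (k + 1) (run plan h₁ r (fun k e => ε k e ω) k).total
      (run plan h₁ r (fun k e => ε k e ω) k).empirical} ≤
      ENNReal.ofReal (δ / 4 * (1 / (k + 1 : ℕ) ^ 2)) := by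
  set Q : ℝ := L * Fintype.card E * Δ with hQdef
  have hQ2 : 2 ≤ Q := by rw [hQdef]; exact_mod_cast hQ
  set t : ℝ := ((k + 1 : ℕ) : ℝ) with ht
  have ht1 : 1 ≤ t := by rw [ht]; push_cast; linarith [Nat.cast_nonneg (α := ℝ) k]
  set ℓ := Real.log (Q * t / δ) with hℓ
  have hQt : 0 < Q * t / δ := by positivity
  have hℓ0 : 0 ≤ ℓ := Real.log_nonneg (by rw [le_div_iff₀ hδ]; nlinarith)
  -- The union runs over pairs, nonzero counts and the two signs of the deviation, at most `4Qt`
  -- events.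
  set I : Finset (((E × Fin (Δ + 1)) × ℕ) × ℝ) :=
    (Finset.univ ×ˢ Finset.Icc 1 k) ×ˢ {1, -1} with hI
  set B : ((E × Fin (Δ + 1)) × ℕ) × ℝ → Set Ω := fun q =>
    {ω | κ * √(q.1.2 * ℓ) ≤ q.2 * ∑ i ∈ Finset.range k, ∑ d ∈
        (run plan h₁ r (fun k e => ε k e ω) i).observed q.1.1.1 q.1.1.2, ε i d ω ∧
      (run plan h₁ r (fun k e => ε k e ω) k).total q.1.1.1 q.1.1.2 ≤ q.1.2} with hB
  have hsub : {ω | r ∉ feasible κ δ L (k + 1) (run plan h₁ r (fun k e => ε k e ω) k).total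
      (run plan h₁ r (fun k e => ε k e ω) k).empirical} ⊆ ⋃ q ∈ I, B q := by
    intro ω hω
    by_contra hcon
    refine hω (mem_feasible_of_noise_le hκ hδ hδ1 hQ hr0 hr1 fun e j hpos => ?_)
    have hnot : ∀ q ∈ I, ω ∉ B q := by
      intro q hq hqB
      exact hcon (Set.mem_biUnion hq hqB)
    set n := (run plan h₁ r (fun k e => ε k e ω) k).total e j with hn
    have hnk : n ≤ k := run_total_le _ _ _ _ _ _ _
    have hmem : ∀ s : ℝ, s = 1 ∨ s = -1 → (((e, j), n), s) ∈ I := by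
      intro s hs
      simp only [hI, Finset.mem_product, Finset.mem_univ, Finset.mem_Icc, Finset.mem_insert,
        Finset.mem_singleton, true_and]
      exact ⟨⟨hpos, hnk⟩, hs⟩
    have h1 := hnot _ (hmem 1 (Or.inl rfl))
    have h2 := hnot _ (hmem (-1) (Or.inr rfl))
    have hfix : ∀ s : ℝ, ω ∉ B (((e, j), n), s) → s * ∑ i ∈ Finset.range k, ∑ d ∈
        (run plan h₁ r (fun k e => ε k e ω) i).observed e j, ε i d ω < κ * √(n * ℓ) := by
      intro s hs
      by_contra hle
      exact hs ⟨not_lt.1 hle, le_of_eq hn.symm⟩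
    have h3 := hfix _ h1
    have h4 := hfix _ h2
    rw [abs_le]
    constructor <;> linarith
  have hexp : Real.exp (-ℓ) = δ / (Q * t) := by
    rw [Real.exp_neg, Real.exp_log hQt, inv_div]
  have hcardI : (I.card : ℝ) ≤ 4 * (Q * t) := by
    have h1 : I.card = Fintype.card E * (Δ + 1) * k * 2 := by
      rw [hI, Finset.card_product, Finset.card_product, Finset.card_univ, Fintype.card_prod,
        Fintype.card_fin, Nat.card_Icc, Finset.card_pair (by norm_num)]
      simp
    have h2 : Fintype.card E * (Δ + 1) * k * 2 ≤
        4 * (L * Fintype.card E * Δ * (k + 1)) := by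
      calc Fintype.card E * (Δ + 1) * k * 2 ≤ Fintype.card E * (2 * Δ) * (k + 1) * 2 := by
            gcongr <;> omega
        _ = 1 * (4 * (Fintype.card E * Δ * (k + 1))) := by ring
        _ ≤ L * (4 * (Fintype.card E * Δ * (k + 1))) := by gcongr; omega
        _ = _ := by ring
    rw [h1, hQdef, ht]
    exact_mod_cast h2
  calc P _ ≤ P (⋃ q ∈ I, B q) := measure_mono hsub
    _ ≤ ∑ q ∈ I, P (B q) := measure_biUnion_finset_le _ _
    _ ≤ ∑ q ∈ I, ENNReal.ofReal (Real.exp (-ℓ) ^ 7) := by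
        refine Finset.sum_le_sum fun q hq => ?_
        simp only [hI, Finset.mem_product, Finset.mem_univ, Finset.mem_Icc, Finset.mem_insert,
          Finset.mem_singleton, true_and] at hq
        refine measure_noise_gt_le hm hg hi hplan k q.1.2 q.1.1.1 q.1.1.2 hq.1.1 ?_ hκ hℓ0
        rcases hq.2 with h | h <;> rw [h] <;> norm_num
    _ = ENNReal.ofReal (I.card * (δ / (Q * t)) ^ 7) := by
        rw [Finset.sum_const, nsmul_eq_mul, hexp, ENNReal.ofReal_mul (Nat.cast_nonneg _),
          ENNReal.ofReal_natCast]
    _ ≤ ENNReal.ofReal (δ / 4 * (1 / t ^ 2)) := by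
        apply ENNReal.ofReal_le_ofReal
        have h1 : (I.card : ℝ) * (δ / (Q * t)) ^ 7 ≤ 4 * (Q * t) * (δ / (Q * t)) ^ 7 := by
          gcongr
        refine h1.trans ?_
        have h2 : 4 * (Q * t) * (δ / (Q * t)) ^ 7 = 4 * δ ^ 7 / (Q ^ 6 * t ^ 6) := by
          field_simp
        have h3 : δ / 4 * (1 / t ^ 2) = δ / (4 * t ^ 2) := by field_simp
        -- One of the seven powers of `Qt` pays for the union over events; the others leave `δ / (4
        -- t ^ 2)`, whose sum over all rounds is at most `δ / 2`.
        rw [h2, h3, div_le_div_iff₀ (by positivity) (by positivity)]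
        have h4 : δ ^ 7 ≤ δ := by
          simpa using pow_le_pow_of_le_one hδ.le hδ1.le (show 1 ≤ 7 by norm_num)
        have h5 : (16 : ℝ) ≤ Q ^ 6 := by
          calc (16 : ℝ) ≤ 2 ^ 6 := by norm_num
            _ ≤ Q ^ 6 := by gcongr
        have h6 : t ^ 2 ≤ t ^ 6 := pow_le_pow_right₀ ht1 (by norm_num)
        calc 4 * δ ^ 7 * (4 * t ^ 2) = δ ^ 7 * (16 * t ^ 2) := by ring
          _ ≤ δ * (Q ^ 6 * t ^ 6) := by gcongr

theorem measure_exists_not_feasible_le (hm : ∀ k e, Measurable (ε k e))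
    (hg : ∀ k e, P.map (ε k e) = gaussianReal 0 1)
    (hi : iIndepFun (fun (k : ℕ) (ω : Ω) (e : E) => ε k e ω) P)
    (hplan : ∀ (t₀ : ℕ) (N : CTable E Δ) (h : History G a b Δ) (π : Policy G a b Δ),
      MeasurableSet {rhat : RTable E Δ | plan t₀ N rhat h = π})
    {κ δ : ℝ} {L : ℕ} (hκ : 10 ≤ κ) (hδ : 0 < δ)
    (hδ1 : δ < 1) (hL0 : 0 < L) (hΔ : 0 < Δ) (hQ : 2 ≤ L * Fintype.card E * Δ)
    (hr0 : ∀ e j, 0 ≤ r e j) (hr1 : ∀ e j, r e j ≤ 1) (T : ℕ) :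
    P {ω | ∃ k < T, r ∉ feasible κ δ L (k + 1) (run plan h₁ r (fun k e => ε k e ω) k).total
      (run plan h₁ r (fun k e => ε k e ω) k).empirical} ≤ ENNReal.ofReal (δ / 2) := by
  have hsub : {ω | ∃ k < T, r ∉ feasible κ δ L (k + 1)
      (run plan h₁ r (fun k e => ε k e ω) k).total
      (run plan h₁ r (fun k e => ε k e ω) k).empirical} ⊆ ⋃ k ∈ Finset.range T,
      {ω | r ∉ feasible κ δ L (k + 1) (run plan h₁ r (fun k e => ε k e ω) k).total
      (run plan h₁ r (fun k e => ε k e ω) k).empirical} := by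
    rintro ω ⟨k, hk, h⟩
    exact Set.mem_biUnion (Finset.mem_range.2 hk) h
  refine (measure_mono hsub).trans ((measure_biUnion_finset_le _ _).trans ?_)
  refine (Finset.sum_le_sum fun k _ =>
    measure_not_feasible_le hm hg hi hplan hκ hδ hδ1 hL0 hΔ hQ hr0 hr1 k).trans ?_
  rw [← ENNReal.ofReal_sum_of_nonneg fun _ _ => by positivity, ← Finset.mul_sum]
  apply ENNReal.ofReal_le_ofReal
  have h1 := sum_inv_sq_le T
  nlinarith

theorem subsingleton_stPath [Subsingleton E] {L : ℕ}
    (hL : ∀ p : STPath G a b, p.edges.length = L) : Subsingleton (STPath G a b) := by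
  refine ⟨fun p q => ?_⟩
  have h : p.edges = q.edges := List.ext_getElem ((hL p).trans (hL q).symm)
    fun _ _ _ => Subsingleton.elim _ _
  cases p
  cases q
  simpa using h

/-- With a single path there is nothing to choose, so the mean rewards cancel and only noise
remains. -/
theorem policyRegret_le_of_subsingleton [Subsingleton (STPath G a b)] [Nonempty (STPath G a b)]
    (ε : ℕ → E → ℝ) (T : ℕ) : policyRegret plan h₁ r ε T ≤
      -∑ i ∈ Finset.range T, ∑ e ∈ (run plan h₁ r ε i).path.edgeSet, ε i e := by
  rw [policyRegret_eq]
  have : ⨆ π : Policy G a b Δ, policyReward r π h₁ T ≤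
      ∑ i ∈ Finset.range T, pathReward r (run plan h₁ r ε i).hist (run plan h₁ r ε i).path := by
    refine ciSup_le fun π => Finset.sum_le_sum fun i _ => le_of_eq ?_
    congr 1
    · exact Subsingleton.elim _ _
    · exact Subsingleton.elim _ _
  linarith

end HighProbability

end CongestedRouting

/-! ### The main theorem -/

open CongestedRouting in
theorem theorem2 (κ : ℝ) (hκ : 10 ≤ κ) :
    ∃ C : ℝ, 0 < C ∧
      ∀ (V : Type*) (E : Type*) [Fintype E] [DecidableEq E] (G : RGraph V E) (a b : V)
        (L Δ : ℕ) (δ : ℝ),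
        Nonempty (STPath G a b) → (∀ p : STPath G a b, p.edges.length = L) →
        0 < L → 0 < Δ → 0 < δ → δ < 1 →
        (∃ plan : Planner G a b Δ, IsOptimisticPlanner κ δ L plan) ∧
        ∀ plan : Planner G a b Δ, IsOptimisticPlanner κ δ L plan →
        ∀ (f : RTable E Δ) (μ : E → ℝ) (h₁ : History G a b Δ) (T : ℕ),
          (∀ e j, 0 < f e j ∧ f e j ≤ 1) → (∀ e, 0 ≤ μ e ∧ μ e ≤ 1) → 0 < T →
        ∀ (Ω : Type*) [MeasurableSpace Ω] (P : Measure Ω) [IsProbabilityMeasure P]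
          (ε : ℕ → E → Ω → ℝ),
          (∀ k e, Measurable (ε k e)) →
          (∀ k e, P.map (ε k e) = gaussianReal 0 1) →
          iIndepFun (fun (k : ℕ) (ω : Ω) (e : E) => ε k e ω) P →
          ENNReal.ofReal (1 - δ) ≤
            P {ω | policyRegret plan h₁ (meanReward f μ) (fun k e => ε k e ω) T ≤
              C * (L * (Δ : ℝ) ^ 2 * Fintype.card E *
                Real.posLog ((L * T : ℝ) / (Δ * Fintype.card E))) +
              C * √(L * Fintype.card E * Δ * T *
                Real.log ((L * Fintype.card E * Δ * T : ℝ) / δ)) +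
              C * √(T * L * Real.log (1 / δ))} := by
  -- The proof needs `15` for the logarithmic term, `8κ + 5` for the square-root term and `2` for
  -- the last one.
  refine ⟨20 + 10 * κ, by linarith, ?_⟩
  intro V E _ _ G a b L Δ δ hne hL hL0 hΔ hδ hδ1
  refine ⟨⟨_, isOptimisticPlanner_optimisticPlanner κ δ L⟩, ?_⟩
  intro plan hplan f μ h₁ T hf hμ hT Ω _ P _ ε hm hg hi
  have hr0 : ∀ e j, 0 ≤ meanReward f μ e j := fun e j => mul_nonneg (hf e j).1.le (hμ e).1
  have hr1 : ∀ e j, meanReward f μ e j ≤ 1 := fun e j =>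
    mul_le_one₀ (hf e j).2 (hμ e).1 (hμ e).2
  generalize meanReward f μ = r at hr0 hr1 ⊢
  obtain ⟨p⟩ := id hne
  have hLE : L ≤ Fintype.card E := by
    rw [← hL p, ← p.card_edgeSet]
    exact Finset.card_le_univ _
  have hT' : (1 : ℝ) ≤ T := by exact_mod_cast hT
  have hL' : (1 : ℝ) ≤ L := by exact_mod_cast hL0
  have hΔ' : (1 : ℝ) ≤ Δ := by exact_mod_cast hΔ
  have hE' : (L : ℝ) ≤ Fintype.card E := by exact_mod_cast hLE
  set Z := L * (Δ : ℝ) ^ 2 * Fintype.card E *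
    Real.posLog ((L * T : ℝ) / (Δ * Fintype.card E)) with hZ
  have hZ0 : 0 ≤ Z := mul_nonneg (by positivity) Real.posLog_nonneg
  set X := √(L * Fintype.card E * Δ * T *
    Real.log ((L * Fintype.card E * Δ * T : ℝ) / δ)) with hX
  have hX0 : 0 ≤ X := Real.sqrt_nonneg _
  set Y := √(T * L * Real.log (1 / δ)) with hY
  have hY0 : 0 ≤ Y := Real.sqrt_nonneg _
  refine ofReal_one_sub_le_measure hδ.le ?_
  rcases Nat.lt_or_ge (Fintype.card E) 2 with hE | hE
  -- For one edge `LEΔt₀` may equal `1`, and the width of an unobserved pair, of order `√log(1/δ)`,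
  -- may be too small for feasibility. The confidence argument is bypassed, and this is where the
  -- last term of the bound is needed.
  · have hL1 : L = 1 := by omega
    have : Subsingleton E := Fintype.card_le_one_iff_subsingleton.1 (by omega)
    have := subsingleton_stPath hL
    refine (measure_mono ?_).trans
      (measure_total_noise_le (h₁ := h₁) (r := r) hm hg hi hplan.measurable hL hL0 hT hδ hδ1.le)
    intro ω hω
    rw [Set.mem_ofPred_eq]
    refine lt_of_not_ge fun hle => hω ?_
    have h1 := policyRegret_le_of_subsingleton (plan := plan) (h₁ := h₁) (r := r)
      (fun k e => ε k e ω) T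
    have h2 : (L : ℝ) * √(2 * T * Real.log (1 / δ)) ≤ 2 * Y := by
      have h3 : √(2 * T * Real.log (1 / δ)) = √2 * Y := by
        rw [hY, hL1, mul_assoc, Real.sqrt_mul (by norm_num)]
        simp
      have h4 : √2 ≤ 2 := Real.sqrt_le_iff.2 (by norm_num)
      rw [h3, hL1, Nat.cast_one, one_mul]
      gcongr
    rw [Set.mem_ofPred_eq]
    nlinarith [mul_nonneg (show 0 ≤ κ by linarith) hZ0, mul_nonneg (show 0 ≤ κ by linarith) hX0,
      mul_nonneg (show 0 ≤ κ by linarith) hY0]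
  · have hQ : 2 ≤ L * Fintype.card E * Δ := by
      calc 2 = 1 * 2 * 1 := by norm_num
        _ ≤ L * Fintype.card E * Δ := by gcongr <;> omega
    have hQT : (2 : ℝ) ≤ L * Fintype.card E * Δ * T := by
      have : (2 : ℝ) ≤ L * Fintype.card E * Δ := by exact_mod_cast hQ
      nlinarith
    have hb1 := measure_exists_not_feasible_le (h₁ := h₁) (r := r) hm hg hi hplan.measurable hκ
      hδ hδ1 hL0 hΔ hQ hr0 hr1 T
    have hb2 := measure_total_noise_le (h₁ := h₁) (r := r) hm hg hi hplan.measurable hL hL0 hT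
      (half_pos hδ) (by linarith)
    have hsum : ENNReal.ofReal δ = ENNReal.ofReal (δ / 2) + ENNReal.ofReal (δ / 2) := by
      rw [← ENNReal.ofReal_add (by linarith) (by linarith), add_halves]
    rw [hsum]
    refine (measure_mono ?_).trans ((measure_union_le _ _).trans (add_le_add hb1 hb2))
    intro ω hω
    by_contra hcon
    rw [Set.mem_union, not_or] at hcon
    obtain ⟨hc1, hc2⟩ := hcon
    have hconf : ∀ k < T, r ∈ feasible κ δ L (k + 1)
        (run plan h₁ r (fun k e => ε k e ω) k).total
        (run plan h₁ r (fun k e => ε k e ω) k).empirical := fun k hk => by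
      by_contra hnot
      exact hc1 ⟨k, hk, hnot⟩
    have h1 := mean_regret_le (by linarith) hδ hδ1 hL0 hΔ hT hE hL hplan hr0 hr1 hconf
    rw [Set.mem_ofPred_eq, not_lt] at hc2
    -- The total noise is absorbed into `X`: a path has distinct edges, so `L ≤ E` and `L ^ 2 T ≤
    -- LEΔT`, while `2 / δ ≤ LEΔT / δ` since there are two edges.
    have h3 : (L : ℝ) * √(2 * T * Real.log (1 / (δ / 2))) ≤ 2 * X := by
      have h4 : Real.log (1 / (δ / 2)) ≤ Real.log ((L * Fintype.card E * Δ * T : ℝ) / δ) := by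
        apply Real.log_le_log (by positivity)
        rw [one_div_div]
        gcongr
      have h5 : 0 ≤ Real.log (1 / (δ / 2)) :=
        Real.log_nonneg (by rw [one_div_div, le_div_iff₀ hδ]; linarith)
      have h6 : (L : ℝ) * √(2 * T * Real.log (1 / (δ / 2))) =
          √(L ^ 2 * (2 * T * Real.log (1 / (δ / 2)))) := by
        rw [Real.sqrt_mul (show (0 : ℝ) ≤ L ^ 2 by positivity), Real.sqrt_sq (by positivity)]
      have h7 : 2 * X = √(2 ^ 2 * (L * Fintype.card E * Δ * T *
          Real.log ((L * Fintype.card E * Δ * T : ℝ) / δ))) := by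
        rw [Real.sqrt_mul (show (0 : ℝ) ≤ 2 ^ 2 by positivity), Real.sqrt_sq (by positivity)]
      rw [h6, h7]
      apply Real.sqrt_le_sqrt
      have h8 : (L : ℝ) ^ 2 * T ≤ L * Fintype.card E * Δ * T := by
        calc (L : ℝ) ^ 2 * T = L * L * 1 * T := by ring
          _ ≤ L * Fintype.card E * Δ * T := by gcongr
      calc (L : ℝ) ^ 2 * (2 * T * Real.log (1 / (δ / 2)))
          = 2 * (L ^ 2 * T * Real.log (1 / (δ / 2))) := by ring
        _ ≤ 2 * (L * Fintype.card E * Δ * T *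
          Real.log ((L * Fintype.card E * Δ * T : ℝ) / δ)) := by gcongr
        _ ≤ _ := by
          have : 0 ≤ L * Fintype.card E * Δ * T *
            Real.log ((L * Fintype.card E * Δ * T : ℝ) / δ) :=
              mul_nonneg (by positivity) (h5.trans h4)
          linarith
    refine hω ?_
    rw [Set.mem_ofPred_eq, policyRegret_eq]
    nlinarith [mul_nonneg (show 0 ≤ κ by linarith) hZ0, mul_nonneg (show 0 ≤ κ by linarith) hX0,
      mul_nonneg (show 0 ≤ κ by linarith) hY0]
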